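/- Let $\Sigma$ be a cusped hyperbolic surface of finite area, i.e. a complete, connected, oriented hyperbolic surface of finite area with at least one cusp, possibly with closed geodesic boundary. Write $\Sigma=\tilde\Sigma/G$, where the universal cover $\tilde\Sigma$ is a closed convex subset of the hyperbolic plane $\mathbb H$ and $G=\pi_1(\Sigma)$ acts on it by deck transformations, i.e. by orientation preserving isometries of $\mathbb H$, freely and properly discontinuously. Let $\partial^\infty\tilde\Sigma\subset\partial\mathbb H$ be the set of accumulation points of $\tilde\Sigma$ at infinity, and let $\partial^\infty_2\tilde\Sigma$ be the space of two-element subsets of $\partial^\infty\tilde\Sigma$ with the Vietoris topology. A geodesic current on $\Sigma$ is a $G$-invariant Borel measure on $\partial_2^\infty\tilde\Sigma$ that is finite on compact sets; $\mu_n$ converges to $\mu$ if $\int f\,d\mu_n\to\int f\,d\mu$ for every continuous function $f:\partial_2^\infty\tilde\Sigma\to\mathbb R$ with compact support. For $A\in\partial_2^\infty\tilde\Sigma$ with stabilizer $\mathrm{Stab}(A)\le G$ put $\eta_A=\sum_{h\,\mathrm{Stab}(A)\in G/\mathrm{Stab}(A)}\delta_{hA}$. For a hyperbolic element $g\in G$,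 let $\Lambda(\langle g\rangle)$ be the limit set of the cyclic group generated by $g$, and put $\eta_g=\sum_{h\langle g\rangle\in G/\langle g\rangle}\delta_{h\Lambda(\langle g\rangle)}$. A parabolic fixed point is a point of $\partial^\infty\tilde\Sigma$ fixed by a parabolic element of $G$. Let $g\in G$ be a hyperbolic element. Then $\Lambda(\langle g\rangle)\in\partial_2^\infty\tilde\Sigma$, the measure $\eta_g$ is a geodesic current, $\eta_{\{p,q\}}$ is a geodesic current for every pair of distinct parabolic fixed points $p,q$, and there is a sequence of pairs $\{p_n,q_n\}$ of distinct parabolic fixed points such that $$\frac1{2n}\,\eta_{\{p_n,q_n\}}\longrightarrow\eta_g\qquad(n\to\infty).$$ One may take $p_n=g^{-n}p$ and $q_n=g^nq$ for any parabolic fixed points $p,q$ (not necessarily distinct): then $p_n\ne q_n$ for all sufficiently large $n$, and every sequence of elements of $\partial_2^\infty\tilde\Sigma$ that equals $\{p_n,q_n\}$ for all sufficiently large $n$ satisfies the displayed convergence. -/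

import Mathlib

open Filter Topology MeasureTheory Matrix
open scoped NNReal MatrixGroups UpperHalfPlane

noncomputable section

namespace CuspedSurface

/-! ### The circle at infinity of the hyperbolic plane

The hyperbolic plane is the upper half-plane `ℍ`, its boundary circle is `OnePoint ℝ = ℝ ∪ {∞}`, and
both are regarded as subsets of the Riemann sphere `OnePoint ℂ`.  The isometry group of `ℍ` is
`PGL(2, ℝ)`; the orientation preserving isometries are the image of `SL(2, ℝ)`. -/

/-- Scalar matrices act trivially on the projective line. -/
theorem scalar_smul_onePoint (u : ℝˣ) (x : OnePoint ℝ) :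
    GeneralLinearGroup.scalar (Fin 2) u • x = x := by
  cases x with
  | infty => simp [OnePoint.smul_infty_eq_ite]
  | coe t => simp [OnePoint.smul_some_eq_ite]

/-- The action of `PGL(2, ℝ)` on the boundary circle by Möbius transformations. -/
instance boundaryAction : MulAction PGL(2, ℝ) (OnePoint ℝ) :=
  ProjGenLinGroup.mulActionOfGL scalar_smul_onePoint

theorem mk_smul_onePoint (A : GL (Fin 2) ℝ) (x : OnePoint ℝ) :
    ProjGenLinGroup.mk A • x = A • x :=
  ProjGenLinGroup.mk_smul ..

/-- An isometry is hyperbolic if it is represented by a matrix with two distinct real eigenvalues. -/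
def IsHyperbolicIsom (γ : PGL(2, ℝ)) : Prop :=
  ∃ A : GL (Fin 2) ℝ, ProjGenLinGroup.mk A = γ ∧ A.IsHyperbolic

/-- An isometry is parabolic if it is represented by a non-scalar matrix with a double eigenvalue. -/
def IsParabolicIsom (γ : PGL(2, ℝ)) : Prop :=
  ∃ A : GL (Fin 2) ℝ, ProjGenLinGroup.mk A = γ ∧ A.IsParabolic

/-- The inclusion of the hyperbolic plane into the Riemann sphere. -/
def planeToSphere (z : ℍ) : OnePoint ℂ := ((z : ℂ) : OnePoint ℂ)

/-- The inclusion of the boundary circle into the Riemann sphere. -/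
def circleToSphere (ξ : OnePoint ℝ) : OnePoint ℂ := OnePoint.map (fun t : ℝ => (t : ℂ)) ξ

/-- The set of accumulation points in the boundary circle of a subset of the hyperbolic plane. -/
def accumulationSet (A : Set ℍ) : Set (OnePoint ℝ) :=
  {ξ | circleToSphere ξ ∈ closure (planeToSphere '' A)}

/-- The geodesic line with endpoints `p ≠ q`: a vertical half-line, or the half-circle that has the
segment from `p` to `q` as a diameter. (The value is empty if `p = q`.) -/
def geodesicLine : OnePoint ℝ → OnePoint ℝ → Set ℍ
  | none, none => ∅
  | none, some b => {z | z.re = b}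
  | some a, none => {z | z.re = a}
  | some a, some b => {z | (z.re - a) * (z.re - b) + z.im ^ 2 = 0}

/-- Convexity in the hyperbolic plane: the geodesic segment from `x` to `y` consists of the points
`w` with `dist x w + dist w y = dist x y`. -/
def GeodesicallyConvex (X : Set ℍ) : Prop :=
  ∀ x ∈ X, ∀ y ∈ X, ∀ w : ℍ, dist x w + dist w y = dist x y → w ∈ X

/-! ### Möbius transformations act continuously on the Riemann sphere -/

/-- The quotient `a / b`, with value `∞` for `b = 0`. -/
def sphereDiv (x : ℂ × ℂ) : OnePoint ℂ := if x.2 = 0 then OnePoint.infty else ((x.1 / x.2 : ℂ))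

theorem continuousAt_sphereDiv {a b : ℂ} (h : a ≠ 0 ∨ b ≠ 0) :
    ContinuousAt sphereDiv (a, b) := by
  by_cases hb : b = 0
  · subst hb
    have ha : a ≠ 0 := by simpa using h
    have hval : sphereDiv (a, 0) = OnePoint.infty := by simp [sphereDiv]
    rw [ContinuousAt, hval, OnePoint.hasBasis_nhds_infty.tendsto_right_iff]
    rintro s ⟨-, hs⟩
    obtain ⟨R, hR⟩ := hs.isBounded.exists_norm_le
    have hopen : ∀ᶠ x : ℂ × ℂ in 𝓝 (a, 0), R * ‖x.2‖ < ‖x.1‖ := by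
      apply IsOpen.mem_nhds (isOpen_lt (by fun_prop) (by fun_prop))
      simpa using ha
    filter_upwards [hopen] with x hx
    by_cases hx2 : x.2 = 0
    · simp [sphereDiv, hx2]
    · left
      refine ⟨x.1 / x.2, fun hmem => ?_, by simp [sphereDiv, hx2]⟩
      have h1 := hR _ hmem
      rw [norm_div, div_le_iff₀ (norm_pos_iff.mpr hx2)] at h1
      linarith
  · have hev : ∀ᶠ x : ℂ × ℂ in 𝓝 (a, b), ((x.1 / x.2 : ℂ) : OnePoint ℂ) = sphereDiv x := by
      have : ∀ᶠ x : ℂ × ℂ in 𝓝 (a, b), x.2 ≠ 0 :=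
        IsOpen.mem_nhds (isOpen_ne_fun continuous_snd continuous_const) hb
      filter_upwards [this] with x hx
      simp [sphereDiv, hx]
    refine ContinuousAt.congr ?_ hev
    exact OnePoint.continuous_coe.continuousAt.comp
      (f := fun x : ℂ × ℂ => x.1 / x.2)
      (continuousAt_fst.div continuousAt_snd hb)

theorem continuous_smul_sphere (A : GL (Fin 2) ℂ) :
    Continuous fun x : OnePoint ℂ => A • x := by
  have hdet : A 0 0 * A 1 1 - A 0 1 * A 1 0 ≠ 0 := by
    have := A.det_ne_zero
    rwa [Matrix.det_fin_two] at this
  have hcoe : ∀ z : ℂ, A • (z : OnePoint ℂ)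
      = sphereDiv (A 0 0 * z + A 0 1, A 1 0 * z + A 1 1) := by
    intro z
    simp [OnePoint.smul_some_eq_ite, sphereDiv]
  rw [OnePoint.continuous_iff]
  constructor
  · have hinf : A • (OnePoint.infty : OnePoint ℂ) = sphereDiv (A 0 0, A 1 0) := by
      simp [OnePoint.smul_infty_eq_ite, sphereDiv]
    rw [hinf, coclosedCompact_eq_cocompact]
    have hinv : Tendsto (fun z : ℂ => z⁻¹) (cocompact ℂ) (𝓝 0) := tendsto_inv₀_cobounded.mono_left
      (by rw [Metric.cobounded_eq_cocompact])
    have hnz : ∀ᶠ z : ℂ in cocompact ℂ, z ≠ 0 := by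
      have : ({0} : Set ℂ)ᶜ ∈ cocompact ℂ := isCompact_singleton.compl_mem_cocompact
      filter_upwards [this] with z hz using hz
    have hlim : Tendsto (fun z : ℂ => (A 0 0 + A 0 1 * z⁻¹, A 1 0 + A 1 1 * z⁻¹))
        (cocompact ℂ) (𝓝 (A 0 0, A 1 0)) := by
      refine Tendsto.prodMk_nhds ?_ ?_
      · simpa using (hinv.const_mul (A 0 1)).const_add (A 0 0)
      · simpa using (hinv.const_mul (A 1 1)).const_add (A 1 0)
    have hne : A 0 0 ≠ 0 ∨ A 1 0 ≠ 0 := by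
      by_contra! hc
      exact hdet (by simp [hc.1, hc.2])
    refine ((continuousAt_sphereDiv hne).tendsto.comp hlim).congr' ?_
    filter_upwards [hnz] with z hz
    rw [hcoe]
    have h0 : A 0 0 * z + A 0 1 = z * (A 0 0 + A 0 1 * z⁻¹) := by field_simp
    have h1 : A 1 0 * z + A 1 1 = z * (A 1 0 + A 1 1 * z⁻¹) := by field_simp
    simp [sphereDiv, h0, h1, hz, mul_div_mul_left]
  · simp_rw [hcoe]
    rw [continuous_iff_continuousAt]
    intro z
    refine (continuousAt_sphereDiv ?_).comp
      (f := fun z : ℂ => (A 0 0 * z + A 0 1, A 1 0 * z + A 1 1)) (by fun_prop)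
    by_contra! hc
    by_cases hc0 : A 1 0 = 0
    · have hd : A 1 1 = 0 := by simpa [hc0] using hc.2
      exact hdet (by simp [hc0, hd])
    · refine hdet (mul_left_cancel₀ hc0 ?_)
      linear_combination (A 1 0 * A 0 0) * hc.2 - A 1 0 * A 1 0 * hc.1

theorem circleToSphere_smul (A : GL (Fin 2) ℝ) (ξ : OnePoint ℝ) :
    circleToSphere (A • ξ) = A.map Complex.ofRealHom • circleToSphere ξ :=
  OnePoint.map_smul Complex.ofRealHom A ξ

theorem planeToSphere_smul (A : SL(2, ℝ)) (z : ℍ) :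
    planeToSphere (A • z)
      = (A : GL (Fin 2) ℝ).map Complex.ofRealHom • planeToSphere z := by
  have hden := UpperHalfPlane.denom_ne_zero (A : GL (Fin 2) ℝ) z
  rw [UpperHalfPlane.denom] at hden
  simp only [planeToSphere, OnePoint.smul_some_eq_ite]
  rw [UpperHalfPlane.coe_specialLinearGroup_apply]
  rw [if_neg (by simpa using hden)]
  simp

/-- An orientation preserving isometry maps the accumulation points of an invariant set to
accumulation points. -/
theorem smul_mem_accumulationSet {X : Set ℍ} {γ : PGL(2, ℝ)}
    (hor : ∃ A : SL(2, ℝ), SpecialLinearGroup.toPGL A = γ) (hX : ∀ z ∈ X, γ • z ∈ X)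
    {ξ : OnePoint ℝ} (hξ : ξ ∈ accumulationSet X) : γ • ξ ∈ accumulationSet X := by
  obtain ⟨A, rfl⟩ := hor
  have h1 : circleToSphere (SpecialLinearGroup.toPGL A • ξ)
      = (A : GL (Fin 2) ℝ).map Complex.ofRealHom • circleToSphere ξ := by
    rw [← circleToSphere_smul]
    exact congrArg circleToSphere (mk_smul_onePoint _ ξ)
  change circleToSphere _ ∈ closure (planeToSphere '' X)
  rw [h1]
  refine map_mem_closure (continuous_smul_sphere _) hξ ?_
  rintro _ ⟨z, hz, rfl⟩
  refine ⟨SpecialLinearGroup.toPGL A • z, hX z hz, ?_⟩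
  have h2 : SpecialLinearGroup.toPGL A • z = A • z := UpperHalfPlane.pglMk_smul _ z
  rw [h2]
  exact planeToSphere_smul A z

/-! ### Hyperbolic surfaces -/

/-- A complete connected oriented hyperbolic surface, possibly with closed geodesic boundary,
presented by its universal cover: a closed convex subset `cover` of the hyperbolic plane with
non-empty interior, and the group `Γ` of deck transformations, which is the fundamental group of the
surface `cover / Γ`. The surface has no boundary precisely if `cover` is the whole plane. -/
structure HyperbolicSurface where
  /-- the fundamental group, acting by deck transformations -/
  Γ : Subgroup PGL(2, ℝ)
  /-- the universal cover -/
  cover : Set ℍ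
  orientation : ∀ γ ∈ Γ, ∃ A : SL(2, ℝ), SpecialLinearGroup.toPGL A = γ
  properlyDiscontinuous : ProperlyDiscontinuousSMul Γ ℍ
  free : ∀ γ ∈ Γ, γ ≠ 1 → ∀ z : ℍ, γ • z ≠ z
  isClosed_cover : IsClosed cover
  convex_cover : GeodesicallyConvex cover
  interior_cover : (interior cover).Nonempty
  invariant : ∀ γ ∈ Γ, ∀ z ∈ cover, γ • z ∈ cover
  /-- every boundary component is a closed geodesic, that is, its lifts are axes of hyperbolic
  elements of the fundamental group -/
  boundary_geodesic : ∀ z ∈ frontier cover, ∃ γ ∈ Γ, IsHyperbolicIsom γ ∧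
    ∃ p q : OnePoint ℝ, p ≠ q ∧ γ • p = p ∧ γ • q = q ∧
      z ∈ geodesicLine p q ∧ geodesicLine p q ⊆ frontier cover

namespace HyperbolicSurface

variable (S : HyperbolicSurface)

/-- The surface has finite area: there is a fundamental domain of finite hyperbolic area for the
action of the fundamental group on the universal cover. -/
def HasFiniteArea : Prop :=
  ∃ F : Set ℍ, IsFundamentalDomain S.Γ F (volume.restrict S.cover) ∧
    volume.restrict S.cover F < ⊤

/-- The surface has at least one cusp. -/
def IsCusped : Prop := ∃ γ ∈ S.Γ, IsParabolicIsom γ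

/-- The boundary at infinity of the universal cover, with the topology of the circle. -/
def Boundary : Type := {ξ : OnePoint ℝ // ξ ∈ accumulationSet S.cover}

instance : TopologicalSpace S.Boundary := instTopologicalSpaceSubtype

instance : MulAction S.Γ S.Boundary where
  smul γ ξ := ⟨γ.1 • ξ.1,
    smul_mem_accumulationSet (S.orientation γ.1 γ.2) (S.invariant γ.1 γ.2) ξ.2⟩
  one_smul ξ := Subtype.ext (one_smul PGL(2, ℝ) ξ.1)
  mul_smul γ δ ξ := Subtype.ext (mul_smul γ.1 δ.1 ξ.1)

/-- The limit set of a subgroup `H` of the fundamental group: the accumulation points at infinity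
of an orbit `H x` of a point `x` of the universal cover. -/
def limitSet (H : Subgroup S.Γ) : Set S.Boundary :=
  {ξ | ∃ x ∈ S.cover, ξ.1 ∈ accumulationSet {y : ℍ | ∃ h ∈ H, y = h • x}}

/-- The fixed points at infinity of the parabolic elements of the fundamental group. -/
def IsParabolicPoint (ξ : S.Boundary) : Prop :=
  ∃ γ : S.Γ, IsParabolicIsom (γ : PGL(2, ℝ)) ∧ γ • ξ = ξ

/-! ### The space of geodesics and geodesic currents -/

/-- The space of subsets of the boundary at infinity with exactly two elements, that is, of
unoriented geodesic lines of the universal cover. -/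
def GeodesicSpace : Type := {A : Set S.Boundary // A.ncard = 2}

/-- The Vietoris topology. -/
instance : TopologicalSpace S.GeodesicSpace :=
  (TopologicalSpace.vietoris S.Boundary).induced Subtype.val

instance : MeasurableSpace S.GeodesicSpace := borel _

instance : BorelSpace S.GeodesicSpace := ⟨rfl⟩

instance : MulAction S.Γ S.GeodesicSpace where
  smul γ A := ⟨(fun ξ => γ • ξ) '' A.1, by
    rw [Set.ncard_image_of_injective _ (MulAction.injective γ), A.2]⟩
  one_smul A := Subtype.ext (by
    change (fun ξ : S.Boundary => (1 : S.Γ) • ξ) '' A.1 = A.1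
    simp)
  mul_smul γ δ A := Subtype.ext (by
    change (fun ξ : S.Boundary => (γ * δ) • ξ) '' A.1
      = (fun ξ : S.Boundary => γ • ξ) '' ((fun ξ : S.Boundary => δ • ξ) '' A.1)
    simp [Set.image_image, mul_smul])

/-- Geodesic currents: Borel measures on the space of geodesics that are invariant under the
fundamental group and finite on compact sets. -/
structure IsGeodesicCurrent (μ : Measure S.GeodesicSpace) : Prop where
  invariant : SMulInvariantMeasure S.Γ S.GeodesicSpace μ
  locally_finite : ∀ K : Set S.GeodesicSpace, IsCompact K → μ K < ⊤

/-- Weak-* convergence: convergence of the integrals of all continuous functions with compact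
support. -/
def WeakStarTendsto (μ : ℕ → Measure S.GeodesicSpace) (ν : Measure S.GeodesicSpace) : Prop :=
  ∀ f : S.GeodesicSpace → ℝ, Continuous f → HasCompactSupport f →
    Tendsto (fun n => ∫ A, f A ∂(μ n)) atTop (𝓝 (∫ A, f A ∂ν))

/-- The counting measure `∑ δ_{γ A}`, the sum being over the cosets `γ H`, for a subgroup `H` that
fixes `A` (so that `γ A` only depends on the coset). -/
def cosetMeasure (H : Subgroup S.Γ) (A : S.GeodesicSpace) : Measure S.GeodesicSpace :=
  Measure.sum fun c : S.Γ ⧸ H => Measure.dirac (c.out • A)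

/-- The counting measure of the orbit of `A`, a sum over the cosets of the stabilizer of `A`. -/
def orbitMeasure (A : S.GeodesicSpace) : Measure S.GeodesicSpace :=
  S.cosetMeasure (MulAction.stabilizer S.Γ A) A

end HyperbolicSurface

end CuspedSurface

end

noncomputable section

namespace CuspedSurface

/-! ### Homogeneous coordinates on the boundary circle -/

/-! Boundary points are represented by vectors of the real plane and deck transformations by
matrices of determinant one, up to sign. The chordal distance of the lines of `v` and `w` in the
Cayley model is `2 |cross v w| / (|v| |w|)`, and `cross` is invariant. Since a compact set of
geodesics has endpoints uniformly apart, a translate by `A` that meets it satisfies an upper bound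
on `‖A v‖ * ‖A w‖` (`norm_mul_norm_le_of_le_spread`). All counting is done with this product and
with discreteness (`hasFiniteBalls_lifts`).

If `v` represents a parabolic fixed point, its orbit stays away from the origin (`exists_le_norm`).
For two such vectors a bound on the product therefore bounds both factors, and only finitely many
`A` remain; this makes the measure of a cuspidal pair locally finite. For the eigenvectors `e`, `f`
of `g`, with eigenvalues `l` and `l⁻¹`, a power of `g` normalises `‖A e‖`, so finitely many cosets
of the cyclic group remain.

For the convergence write `v = a e + b f` and `w = c e + d f`. All four coordinates are nonzero, as
powers of `g` contract eigenvectors to zero. The determinant of `g⁻ⁿ v` and `gⁿ w` is `O(l²ⁿ)`. A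
relevant translate either belongs to one of two families of bounded size near the cusps, or `f`
dominates at the first end and `e` at the second. In the latter case the translate of the axis is
itself in a bounded set, so the translating element is `c gʲ` with `c` from a finite set of coset
representatives and `|j| ≤ n + J` (`exists_finite_ends`).

The stabilizer of a cuspidal pair is trivial, so the integral of a test function is a sum over the
whole group: finitely many sums over `|j| ≤ n + J`, plus a bounded error. When `n - |j|` is large,
`gʲ` moves the pair close to the axis, so division by `2n` gives averages converging to the values
at the translates of the axis (`tendsto_average`). -/

/-- The determinant of the matrix with columns `v` and `w`. -/
def cross (v w : Fin 2 → ℝ) : ℝ := v 0 * w 1 - v 1 * w 0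

/-- The point of the boundary circle with homogeneous coordinates `v`. -/
def toLine (v : Fin 2 → ℝ) : OnePoint ℝ :=
  if v 1 = 0 then OnePoint.infty else ((v 0 / v 1 : ℝ) : OnePoint ℝ)

theorem exists_toLine (ξ : OnePoint ℝ) : ∃ v : Fin 2 → ℝ, v ≠ 0 ∧ toLine v = ξ := by
  cases ξ with
  | infty => exact ⟨![1, 0], fun h => by simpa using congrFun h 0, by simp [toLine]⟩
  | coe a => exact ⟨![a, 1], fun h => by simpa using congrFun h 1, by simp [toLine]⟩

theorem ne_zero_iff_fin_two {v : Fin 2 → ℝ} : v ≠ 0 ↔ v 0 ≠ 0 ∨ v 1 ≠ 0 := by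
  rw [Ne, funext_iff, Fin.forall_fin_two]
  simp only [Pi.zero_apply]
  tauto

theorem mulVec_fin_two (A : Matrix (Fin 2) (Fin 2) ℝ) (v : Fin 2 → ℝ) (i : Fin 2) :
    (A *ᵥ v) i = A i 0 * v 0 + A i 1 * v 1 := by
  simp [Matrix.mulVec, dotProduct, Fin.sum_univ_two]

theorem det_eq_one_fin_two (A : SL(2, ℝ)) : A.1 0 0 * A.1 1 1 - A.1 0 1 * A.1 1 0 = 1 := by
  have := A.2
  rwa [Matrix.det_fin_two] at this

theorem cross_mulVec (A : SL(2, ℝ)) (v w : Fin 2 → ℝ) :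
    cross (A.1 *ᵥ v) (A.1 *ᵥ w) = cross v w := by
  simp only [cross, mulVec_fin_two]
  linear_combination (v 0 * w 1 - v 1 * w 0) * det_eq_one_fin_two A

theorem cross_smul_left (c : ℝ) (v w : Fin 2 → ℝ) : cross (c • v) w = c * cross v w := by
  simp [cross]; ring

theorem cross_smul_right (c : ℝ) (v w : Fin 2 → ℝ) : cross v (c • w) = c * cross v w := by
  simp [cross]; ring

theorem cross_comm (v w : Fin 2 → ℝ) : cross v w = -cross w v := by
  simp [cross]; ring

theorem mulVec_ne_zero (A : SL(2, ℝ)) {v : Fin 2 → ℝ} (hv : v ≠ 0) : A.1 *ᵥ v ≠ 0 := by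
  intro h
  apply hv
  have h2 : (A⁻¹).1 *ᵥ (A.1 *ᵥ v) = v := by
    rw [mulVec_mulVec, show (A⁻¹).1 * A.1 = (A⁻¹ * A).1 from rfl, inv_mul_cancel]
    exact one_mulVec v
  rw [← h2, h, mulVec_zero]

theorem mul_mulVec (A B : SL(2, ℝ)) (v : Fin 2 → ℝ) :
    (A * B).1 *ᵥ v = A.1 *ᵥ (B.1 *ᵥ v) := by
  rw [mulVec_mulVec]; rfl

theorem toLine_eq_iff {v w : Fin 2 → ℝ} (hv : v ≠ 0) (hw : w ≠ 0) :
    toLine v = toLine w ↔ cross v w = 0 := by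
  rw [ne_zero_iff_fin_two] at hv hw
  unfold toLine cross
  split_ifs with h1 h2 h2
  · simp [h1, h2]
  · have : v 0 ≠ 0 := by tauto
    simp [h1, h2, this]
  · have : w 0 ≠ 0 := by tauto
    simp [h1, h2, this]
  · rw [OnePoint.coe_eq_coe, div_eq_div_iff h1 h2, sub_eq_zero, mul_comm (v 1)]

theorem cross_eq_zero_iff {v w : Fin 2 → ℝ} (hw : w ≠ 0) :
    cross v w = 0 ↔ ∃ c : ℝ, v = c • w := by
  constructor
  · intro h
    rw [ne_zero_iff_fin_two] at hw
    unfold cross at h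
    rcases hw with hw | hw
    · refine ⟨v 0 / w 0, ?_⟩
      ext i; fin_cases i
      · simp [hw]
      · simp; field_simp; linarith
    · refine ⟨v 1 / w 1, ?_⟩
      ext i; fin_cases i
      · simp; field_simp; linarith
      · simp [hw]
  · rintro ⟨c, rfl⟩
    simp [cross]; ring

theorem toLine_smul {c : ℝ} (hc : c ≠ 0) (v : Fin 2 → ℝ) : toLine (c • v) = toLine v := by
  simp [toLine, hc, mul_div_mul_left]

theorem toPGL_smul_toLine (A : SL(2, ℝ)) {v : Fin 2 → ℝ} (hv : v ≠ 0) :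
    SpecialLinearGroup.toPGL A • toLine v = toLine (A.1 *ᵥ v) := by
  have h1 : SpecialLinearGroup.toPGL A • toLine v = (A : GL (Fin 2) ℝ) • toLine v :=
    mk_smul_onePoint _ _
  rw [h1]
  rw [ne_zero_iff_fin_two] at hv
  have hd := det_eq_one_fin_two A
  by_cases h : v 1 = 0
  · have h0 : v 0 ≠ 0 := by tauto
    have e : toLine v = OnePoint.infty := by simp [toLine, h]
    rw [e, OnePoint.smul_infty_eq_ite]
    change (if A.1 1 0 = 0 then OnePoint.infty else ((A.1 0 0 / A.1 1 0 : ℝ) : OnePoint ℝ)) = _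
    simp [toLine, mulVec_fin_two, h, h0, mul_div_mul_right]
  · have e1 : A.1 1 0 * (v 0 / v 1) + A.1 1 1 = (A.1 1 0 * v 0 + A.1 1 1 * v 1) / v 1 := by
      field_simp
    have e0 : A.1 0 0 * (v 0 / v 1) + A.1 0 1 = (A.1 0 0 * v 0 + A.1 0 1 * v 1) / v 1 := by
      field_simp
    simp [toLine, mulVec_fin_two, h, OnePoint.smul_some_eq_ite, e1, e0, div_div_div_cancel_right₀]

theorem mulVec_eq_smul_of_fixed (A : SL(2, ℝ)) {v : Fin 2 → ℝ} (hv : v ≠ 0)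
    (h : SpecialLinearGroup.toPGL A • toLine v = toLine v) : ∃ c : ℝ, A.1 *ᵥ v = c • v := by
  rw [toPGL_smul_toLine A hv, toLine_eq_iff (mulVec_ne_zero A hv) hv] at h
  exact (cross_eq_zero_iff hv).1 h

/-! ### The Cayley model and the chordal distance -/

/-- The complex number with real and imaginary part the coordinates of `v`. -/
def toComplex (v : Fin 2 → ℝ) : ℂ := ⟨v 0, v 1⟩

theorem toComplex_ne_zero {v : Fin 2 → ℝ} (hv : v ≠ 0) : toComplex v ≠ 0 := by
  rw [ne_zero_iff_fin_two] at hv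
  intro h
  have h0 := congrArg Complex.re h
  have h1 := congrArg Complex.im h
  simp [toComplex] at h0 h1
  tauto

theorem norm_le_norm_toComplex (v : Fin 2 → ℝ) : ‖v‖ ≤ ‖toComplex v‖ := by
  rw [pi_norm_le_iff_of_nonneg (norm_nonneg _), Fin.forall_fin_two]
  exact ⟨Complex.abs_re_le_norm (toComplex v), Complex.abs_im_le_norm (toComplex v)⟩

theorem continuous_toComplex : Continuous toComplex := by
  have : toComplex = fun v => (v 0 : ℂ) + (v 1 : ℂ) * Complex.I := by
    ext v
    apply Complex.ext <;> simp [toComplex]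
  rw [this]
  fun_prop

/-- The Cayley embedding of the boundary circle as the unit circle in the plane. -/
def cayley : OnePoint ℝ → ℂ
  | none => 1
  | some a => (a + Complex.I) / (a - Complex.I)

theorem cayley_toLine {v : Fin 2 → ℝ} (hv : v ≠ 0) :
    cayley (toLine v) = toComplex v / (starRingEnd ℂ) (toComplex v) := by
  have hv' := toComplex_ne_zero hv
  have hv2 : (starRingEnd ℂ) (toComplex v) ≠ 0 := by simpa using hv'
  rw [ne_zero_iff_fin_two] at hv
  have e : toComplex v = (v 0 : ℂ) + (v 1 : ℂ) * Complex.I := by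
    apply Complex.ext <;> simp [toComplex]
  have e2 : (starRingEnd ℂ) (toComplex v) = (v 0 : ℂ) - (v 1 : ℂ) * Complex.I := by
    apply Complex.ext <;> simp [toComplex]
  rw [e2] at hv2
  rw [e2, e]
  unfold toLine
  split_ifs with h
  · have h0 : v 0 ≠ 0 := by tauto
    change (1 : ℂ) = _
    simp [h, h0]
  · change (((v 0 / v 1 : ℝ) : ℂ) + Complex.I) / (((v 0 / v 1 : ℝ) : ℂ) - Complex.I) = _
    have h' : (v 1 : ℂ) ≠ 0 := by exact_mod_cast h
    push_cast
    rw [← mul_div_mul_left _ _ h']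
    congr 1 <;> field_simp

/-- Over the common denominator the numerator is `z w̄ - z̄ w`, which is `-2i` times the determinant
of the two vectors. As `cross` is invariant under determinant one, separation of endpoints becomes a
bound on norms. -/
theorem dist_cayley_toLine {v w : Fin 2 → ℝ} (hv : v ≠ 0) (hw : w ≠ 0) :
    dist (cayley (toLine v)) (cayley (toLine w)) * (‖toComplex v‖ * ‖toComplex w‖)
      = 2 * |cross v w| := by
  have hv' := toComplex_ne_zero hv
  have hw' := toComplex_ne_zero hw
  have hv2 : (starRingEnd ℂ) (toComplex v) ≠ 0 := by simpa using hv'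
  have hw2 : (starRingEnd ℂ) (toComplex w) ≠ 0 := by simpa using hw'
  rw [cayley_toLine hv, cayley_toLine hw, dist_eq_norm, div_sub_div _ _ hv2 hw2, norm_div,
    norm_mul, RCLike.norm_conj, RCLike.norm_conj,
    div_mul_cancel₀ _ (mul_ne_zero (norm_ne_zero_iff.2 hv') (norm_ne_zero_iff.2 hw'))]
  have : toComplex v * (starRingEnd ℂ) (toComplex w)
      - (starRingEnd ℂ) (toComplex v) * toComplex w = ((-2 * cross v w : ℝ) : ℂ) * Complex.I := by
    apply Complex.ext
    · simp [toComplex, cross]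
    · simp [toComplex, cross]
      ring
  rw [this, norm_mul, Complex.norm_I, Complex.norm_real]
  simp

theorem continuous_cayley : Continuous cayley := by
  have hne : ∀ a : ℝ, (a : ℂ) - Complex.I ≠ 0 := by
    intro a h
    have := congrArg Complex.im h
    simp at this
  rw [OnePoint.continuous_iff]
  constructor
  · rw [coclosedCompact_eq_cocompact]
    have h1 : Tendsto (fun a : ℝ => (a : ℂ) - Complex.I) (cocompact ℝ) (cocompact ℂ) := by
      have := (Complex.isometry_ofReal.isClosedEmbedding.tendsto_cocompact).comp (tendsto_id (α := ℝ))
      exact ((Homeomorph.subRight Complex.I).isClosedEmbedding.tendsto_cocompact).comp this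
    have h2 : Tendsto (fun a : ℝ => ((a : ℂ) - Complex.I)⁻¹) (cocompact ℝ) (𝓝 0) :=
      (tendsto_inv₀_cobounded.mono_left (by rw [Metric.cobounded_eq_cocompact])).comp h1
    -- Continuity at infinity is read off from `(a + i) / (a - i) = 1 + 2i / (a - i)`.
    have h3 : Tendsto (fun a : ℝ => 1 + 2 * Complex.I * ((a : ℂ) - Complex.I)⁻¹)
        (cocompact ℝ) (𝓝 (1 + 2 * Complex.I * 0)) := (h2.const_mul _).const_add _
    rw [mul_zero, add_zero] at h3
    refine h3.congr fun a => ?_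
    change _ = (a + Complex.I) / (a - Complex.I)
    have := hne a
    field_simp
    ring
  · change Continuous fun a : ℝ => ((a : ℂ) + Complex.I) / (a - Complex.I)
    exact Continuous.div (by fun_prop) (by fun_prop) hne

theorem injective_cayley : Function.Injective cayley := by
  intro ξ η h
  obtain ⟨v, hv, rfl⟩ := exists_toLine ξ
  obtain ⟨w, hw, rfl⟩ := exists_toLine η
  have := dist_cayley_toLine hv hw
  rw [h, dist_self, zero_mul] at this
  rw [toLine_eq_iff hv hw]
  simpa using this.symm

theorem isEmbedding_cayley : IsEmbedding cayley :=
  (continuous_cayley.isClosedEmbedding injective_cayley).isEmbedding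

theorem tendsto_toLine {ι : Type*} {l : Filter ι} {u : ι → Fin 2 → ℝ} {v : Fin 2 → ℝ}
    (hu : ∀ᶠ i in l, u i ≠ 0) (hv : v ≠ 0) (h : Tendsto u l (𝓝 v)) :
    Tendsto (fun i => toLine (u i)) l (𝓝 (toLine v)) := by
  rw [isEmbedding_cayley.tendsto_nhds_iff, cayley_toLine hv]
  have hv2 : (starRingEnd ℂ) (toComplex v) ≠ 0 := by simpa using toComplex_ne_zero hv
  have h1 := (continuous_toComplex.tendsto v).comp h
  refine (h1.div ((Complex.continuous_conj.tendsto _).comp h1) hv2).congr' ?_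
  filter_upwards [hu] with i hi
  simp [cayley_toLine hi]

/-! ### Discrete groups of matrices -/

/-- A group of matrices with only finitely many elements in each bounded set. -/
def HasFiniteBalls (G : Subgroup SL(2, ℝ)) : Prop :=
  ∀ R : ℝ, {A : SL(2, ℝ) | A ∈ G ∧ ∀ i j, |A.1 i j| ≤ R}.Finite

/-- A matrix is determined by the images of the basis `v`, `w`: Cramer's rule bounds its entries by
the norms of these images, divided by the determinant of the basis. -/
theorem HasFiniteBalls.finite_of_norm_le {G : Subgroup SL(2, ℝ)} (hG : HasFiniteBalls G)
    {v w : Fin 2 → ℝ} (h : cross v w ≠ 0) (R : ℝ) :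
    {A : SL(2, ℝ) | A ∈ G ∧ ‖A.1 *ᵥ v‖ ≤ R ∧ ‖A.1 *ᵥ w‖ ≤ R}.Finite := by
  refine (hG ((‖w‖ * R + ‖v‖ * R) / |cross v w|)).subset ?_
  rintro A ⟨hA, h1, h2⟩
  refine ⟨hA, ?_⟩
  have hn : ∀ (u : Fin 2 → ℝ) i, |u i| ≤ ‖u‖ := fun u i => norm_le_pi_norm u i
  have key : ∀ (i : Fin 2) (a b c : ℝ), |a| ≤ ‖w‖ → |b| ≤ ‖v‖ →
      c * cross v w = a * (A.1 *ᵥ v) i - b * (A.1 *ᵥ w) i →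
      |c| ≤ (‖w‖ * R + ‖v‖ * R) / |cross v w| := by
    intro i a b c ha hb hc
    rw [le_div_iff₀ (abs_pos.2 h), ← abs_mul, hc]
    calc _ ≤ |a * (A.1 *ᵥ v) i| + |b * (A.1 *ᵥ w) i| := abs_sub _ _
      _ = |a| * |(A.1 *ᵥ v) i| + |b| * |(A.1 *ᵥ w) i| := by rw [abs_mul, abs_mul]
      _ ≤ _ := by
        gcongr
        · exact (hn _ i).trans h1
        · exact (hn _ i).trans h2
  intro i j
  fin_cases j
  · refine key i (w 1) (v 1) _ (hn w 1) (hn v 1) ?_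
    simp only [mulVec_fin_two, cross, Fin.zero_eta]
    ring
  · refine key i (-w 0) (-v 0) _ (by rw [abs_neg]; exact hn w 0) (by rw [abs_neg]; exact hn v 0) ?_
    simp only [mulVec_fin_two, cross, Fin.mk_one]
    ring

/-- With an eigenvalue 1 and determinant 1 the trace is 2, so `t - 1` kills `v` and maps into the
line of `v`. Hence `t u = u + s (cross v u) v`, and the displayed matrix is the product of the
column `v` with the row `(-v 1, v 0)`. -/
theorem exists_transvection {t : SL(2, ℝ)} {v : Fin 2 → ℝ} (hv : v ≠ 0) (ht : t.1 *ᵥ v = v) :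
    ∃ s : ℝ, t.1 = 1 + s • !![-(v 0 * v 1), v 0 ^ 2; -v 1 ^ 2, v 0 * v 1] := by
  have hd := det_eq_one_fin_two t
  have h0 := congrFun ht 0
  have h1 := congrFun ht 1
  rw [mulVec_fin_two] at h0 h1
  set a := t.1 0 0
  set b := t.1 0 1
  set c := t.1 1 0
  set d := t.1 1 1
  have htr : a + d = 2 := by
    have e0 : (a + d - 2) * v 0 = 0 := by
      linear_combination (-d + 1) * h0 + b * h1 + v 0 * hd
    have e1 : (a + d - 2) * v 1 = 0 := by
      linear_combination (-a + 1) * h1 + c * h0 + v 1 * hd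
    rw [ne_zero_iff_fin_two] at hv
    rcases hv with hv | hv
    · have := (mul_eq_zero.1 e0).resolve_right hv; linarith
    · have := (mul_eq_zero.1 e1).resolve_right hv; linarith
  have key : ∃ s : ℝ, a = 1 - s * (v 0 * v 1) ∧ b = s * v 0 ^ 2 ∧ c = -(s * v 1 ^ 2) ∧
      d = 1 + s * (v 0 * v 1) := by
    rw [ne_zero_iff_fin_two] at hv
    rcases hv with hv | hv
    · have e1 : b / v 0 ^ 2 * (v 0 * v 1) = 1 - a := by field_simp; linarith
      have e2 : b / v 0 ^ 2 * v 1 ^ 2 = -c := by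
        have : b / v 0 ^ 2 * v 1 ^ 2 * v 0 = -c * v 0 := by
          have : b / v 0 ^ 2 * v 1 ^ 2 * v 0 = (b / v 0 ^ 2 * (v 0 * v 1)) * v 1 := by ring
          rw [this, e1]; linear_combination h1 - v 1 * htr
        exact mul_right_cancel₀ hv this
      exact ⟨b / v 0 ^ 2, by linarith, by field_simp, by linarith, by linarith⟩
    · have e1 : -c / v 1 ^ 2 * (v 0 * v 1) = d - 1 := by field_simp; linarith
      have e2 : -c / v 1 ^ 2 * v 0 ^ 2 = b := by
        have : -c / v 1 ^ 2 * v 0 ^ 2 * v 1 = b * v 1 := by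
          have : -c / v 1 ^ 2 * v 0 ^ 2 * v 1 = (-c / v 1 ^ 2 * (v 0 * v 1)) * v 0 := by ring
          rw [this, e1]; linear_combination v 0 * htr - h0
        exact mul_right_cancel₀ hv this
      exact ⟨-c / v 1 ^ 2, by linarith, by linarith, by field_simp, by linarith⟩
  obtain ⟨s, ha, hb, hc, hd'⟩ := key
  refine ⟨s, ?_⟩
  ext i j
  fin_cases i <;> fin_cases j
  · change a = _; rw [ha]; simp; ring
  · change b = _; rw [hb]; simp
  · change c = _; rw [hc]; simp
  · change d = _; rw [hd']; simp

/-- The orbit of a vector fixed by a parabolic element of a discrete group does not accumulate at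
the origin. -/
theorem HasFiniteBalls.exists_le_norm {G : Subgroup SL(2, ℝ)} (hG : HasFiniteBalls G)
    {t : SL(2, ℝ)} (htG : t ∈ G) (ht1 : t ≠ 1) {v : Fin 2 → ℝ} (hv : v ≠ 0)
    (ht : t.1 *ᵥ v = v) : ∃ ε > 0, ∀ A ∈ G, ε ≤ ‖A.1 *ᵥ v‖ := by
  obtain ⟨s, hs⟩ := exists_transvection hv ht
  have hs0 : s ≠ 0 := by
    rintro rfl
    exact ht1 (Subtype.ext (by simpa using hs))
  have hn : ∀ (u : Fin 2 → ℝ) i, |u i| ≤ ‖u‖ := fun u i => norm_le_pi_norm u i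
  -- The conjugate by `A` is the transvection along `A v` with the same parameter `s`, so a short
  -- vector `A v` yields a small conjugate, of which a discrete group has few.
  have hconj : ∀ A : SL(2, ℝ), (A * t * A⁻¹).1 = 1 + s • !![-((A.1 *ᵥ v) 0 * (A.1 *ᵥ v) 1),
      (A.1 *ᵥ v) 0 ^ 2; -(A.1 *ᵥ v) 1 ^ 2, (A.1 *ᵥ v) 0 * (A.1 *ᵥ v) 1] := by
    intro A
    have hdet := det_eq_one_fin_two A
    have h1 : (A * t * A⁻¹).1 = A.1 * t.1 * A.1.adjugate := by
      simp
    rw [h1, hs, Matrix.adjugate_fin_two]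
    ext i j
    fin_cases i <;> fin_cases j <;>
      simp [Matrix.mul_apply, Fin.sum_univ_two, mulVec_fin_two] <;>
      first | ring1 | linear_combination hdet
  -- The off-diagonal entries of the conjugate are `s (A v)₀²` and `-s (A v)₁²`; `val` recovers the
  -- norm of `A v` from them.
  let val : SL(2, ℝ) → ℝ := fun B => √(max |B.1 0 1| |B.1 1 0| / |s|)
  have hval : ∀ A : SL(2, ℝ), val (A * t * A⁻¹) = ‖A.1 *ᵥ v‖ := by
    intro A
    have : ‖A.1 *ᵥ v‖ = max |(A.1 *ᵥ v) 0| |(A.1 *ᵥ v) 1| := by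
      apply le_antisymm
      · rw [pi_norm_le_iff_of_nonneg (by positivity), Fin.forall_fin_two]
        exact ⟨le_max_left _ _, le_max_right _ _⟩
      · exact max_le (hn _ 0) (hn _ 1)
    simp only [val, hconj]
    rw [Real.sqrt_eq_iff_mul_self_eq_of_pos (by rw [norm_pos_iff]; exact mulVec_ne_zero A hv),
      this]
    generalize (A.1 *ᵥ v) 0 = x
    generalize (A.1 *ᵥ v) 1 = y
    simp [abs_mul]
    rw [← mul_max_of_nonneg _ _ (abs_nonneg s), mul_div_cancel_left₀ _ (abs_ne_zero.2 hs0)]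
    rcases le_total |x| |y| with h | h
    · rw [max_eq_right h, max_eq_right (sq_le_sq.2 h), ← sq, sq_abs]
    · rw [max_eq_left h, max_eq_left (sq_le_sq.2 h), ← sq, sq_abs]
  set T : Set SL(2, ℝ) := {B | B ∈ G ∧ ∀ i j, |B.1 i j| ≤ 1 + |s|}
  -- The value 0 has to be removed, since the identity lies in `T`. The remaining finite set of
  -- values misses a neighbourhood of 0.
  have hT : (val '' T \ {0}).Finite := ((hG _).image _).sdiff
  have hnhds : (val '' T \ {0})ᶜ ∈ 𝓝 (0 : ℝ) := hT.isClosed.compl_mem_nhds (by simp)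
  obtain ⟨ε, hε, hball⟩ := Metric.mem_nhds_iff.1 hnhds
  refine ⟨min ε 1, by positivity, fun A hA => ?_⟩
  by_contra! hlt
  rw [lt_min_iff] at hlt
  have hmem : ‖A.1 *ᵥ v‖ ∈ Metric.ball (0 : ℝ) ε := by simpa using hlt.1
  refine hball hmem ⟨⟨A * t * A⁻¹, ⟨?_, ?_⟩, hval A⟩, ?_⟩
  · exact G.mul_mem (G.mul_mem hA htG) (G.inv_mem hA)
  · have b0 : |(A.1 *ᵥ v) 0| ≤ 1 := (hn _ 0).trans hlt.2.le
    have b1 : |(A.1 *ᵥ v) 1| ≤ 1 := (hn _ 1).trans hlt.2.le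
    have b00 : (A.1 *ᵥ v) 0 ^ 2 ≤ 1 := by rwa [sq_le_one_iff_abs_le_one]
    have b11 : (A.1 *ᵥ v) 1 ^ 2 ≤ 1 := by rwa [sq_le_one_iff_abs_le_one]
    have b01 : |(A.1 *ᵥ v) 0 * (A.1 *ᵥ v) 1| ≤ 1 := by
      rw [abs_mul]; exact mul_le_one₀ b0 (abs_nonneg _) b1
    have gen : ∀ (e x : ℝ), |e| ≤ 1 → |x| ≤ 1 → |e + s * x| ≤ 1 + |s| := by
      intro e x he hx
      calc |e + s * x| ≤ |e| + |s * x| := abs_add_le _ _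
        _ = |e| + |s| * |x| := by rw [abs_mul]
        _ ≤ 1 + |s| * 1 := by gcongr
        _ = _ := by ring
    intro i j
    rw [hconj]
    fin_cases i <;> fin_cases j
    · exact gen _ _ (by simp) (by simpa using b01)
    · exact gen _ _ (by simp) (by simpa using b00)
    · exact gen _ _ (by simp) (by simpa using b11)
    · exact gen _ _ (by simp) (by simpa using b01)
  · simpa using mulVec_ne_zero A hv

/-- There are only finitely many pairs of translates of two such vectors for which the product of
the norms is bounded. -/
theorem HasFiniteBalls.finite_of_norm_mul_le {G : Subgroup SL(2, ℝ)} (hG : HasFiniteBalls G)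
    {v w : Fin 2 → ℝ} (h : cross v w ≠ 0) (hv : ∃ ε > 0, ∀ A ∈ G, ε ≤ ‖A.1 *ᵥ v‖)
    (hw : ∃ ε > 0, ∀ A ∈ G, ε ≤ ‖A.1 *ᵥ w‖) (M : ℝ) :
    {A : SL(2, ℝ) | A ∈ G ∧ ‖A.1 *ᵥ v‖ * ‖A.1 *ᵥ w‖ ≤ M}.Finite := by
  obtain ⟨ε, hε, hv⟩ := hv
  obtain ⟨δ, hδ, hw⟩ := hw
  refine (hG.finite_of_norm_le h (max (M / δ) (M / ε))).subset ?_
  rintro A ⟨hA, hM⟩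
  have h1 := hv A hA
  have h2 := hw A hA
  refine ⟨hA, le_max_of_le_left ?_, le_max_of_le_right ?_⟩
  · rw [le_div_iff₀ hδ]
    exact (mul_le_mul_of_nonneg_left h2 (norm_nonneg _)).trans hM
  · rw [le_div_iff₀ hε, mul_comm]
    exact (mul_le_mul_of_nonneg_right h1 (norm_nonneg _)).trans hM

theorem zpow_mulVec {A : SL(2, ℝ)} {v : Fin 2 → ℝ} {c : ℝ} (hc : c ≠ 0)
    (h : A.1 *ᵥ v = c • v) (n : ℤ) : (A ^ n).1 *ᵥ v = c ^ n • v := by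
  have hinv : (A⁻¹).1 *ᵥ v = c⁻¹ • v := by
    have : (A⁻¹).1 *ᵥ (A.1 *ᵥ v) = v := by
      rw [← mul_mulVec, inv_mul_cancel]; exact one_mulVec v
    rw [h, mulVec_smul] at this
    rw [← this, smul_smul, inv_mul_cancel₀ hc, one_smul, this]
  induction n with
  | zero => simp
  | succ n ih =>
    rw [_root_.zpow_add_one, mul_mulVec, h, mulVec_smul, ih, smul_smul, zpow_add_one₀ hc, mul_comm]
  | pred n ih =>
    rw [_root_.zpow_sub_one, mul_mulVec, hinv, mulVec_smul, ih, smul_smul, zpow_sub_one₀ hc, mul_comm]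

/-! ### Discrete groups with a hyperbolic element -/

/-- The vectors `e` and `f` form a basis of eigenvectors of `g` for the eigenvalues `l` and `l⁻¹`,
where `l > 1`. -/
structure IsEigenbasis (g : SL(2, ℝ)) (l : ℝ) (e f : Fin 2 → ℝ) : Prop where
  one_lt : 1 < l
  map_left : g.1 *ᵥ e = l • e
  map_right : g.1 *ᵥ f = l⁻¹ • f
  cross_ne : cross e f ≠ 0

namespace IsEigenbasis

variable {g : SL(2, ℝ)} {l : ℝ} {e f : Fin 2 → ℝ}

theorem pos (h : IsEigenbasis g l e f) : 0 < l := one_pos.trans h.one_lt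

theorem left_ne (h : IsEigenbasis g l e f) : e ≠ 0 := by
  rintro rfl
  exact h.cross_ne (by simp [cross])

theorem right_ne (h : IsEigenbasis g l e f) : f ≠ 0 := by
  rintro rfl
  exact h.cross_ne (by simp [cross])

theorem symm (h : IsEigenbasis g l e f) : IsEigenbasis g⁻¹ l f e where
  one_lt := h.one_lt
  map_left := by
    have := zpow_mulVec (inv_ne_zero h.pos.ne') h.map_right (-1)
    simpa using this
  map_right := by
    have := zpow_mulVec h.pos.ne' h.map_left (-1)
    simpa using this
  cross_ne := by
    rw [cross_comm]
    exact neg_ne_zero.2 h.cross_ne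

theorem zpow_left (h : IsEigenbasis g l e f) (n : ℤ) : (g ^ n).1 *ᵥ e = l ^ n • e :=
  zpow_mulVec h.pos.ne' h.map_left n

theorem zpow_right (h : IsEigenbasis g l e f) (n : ℤ) : (g ^ n).1 *ᵥ f = l ^ (-n) • f := by
  rw [zpow_mulVec (inv_ne_zero h.pos.ne') h.map_right n, _root_.inv_zpow, _root_.zpow_neg]

theorem exists_coords (h : IsEigenbasis g l e f) (v : Fin 2 → ℝ) :
    ∃ a b : ℝ, v = a • e + b • f := by
  have := h.cross_ne
  refine ⟨cross v f / cross e f, cross e v / cross e f, ?_⟩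
  ext i
  simp only [Pi.add_apply, Pi.smul_apply, smul_eq_mul]
  field_simp
  fin_cases i <;> simp [cross] <;> ring

theorem zpow_coords (h : IsEigenbasis g l e f) (a b : ℝ) (n : ℤ) :
    (g ^ n).1 *ᵥ (a • e + b • f) = (a * l ^ n) • e + (b * l ^ (-n)) • f := by
  rw [mulVec_add, mulVec_smul, mulVec_smul, h.zpow_left, h.zpow_right, smul_smul, smul_smul]

variable {G : Subgroup SL(2, ℝ)}

/-- The elements moving the axis of `g` to a bounded set of geodesics form finitely many cosets. -/
theorem exists_finite_cosets (h : IsEigenbasis g l e f) (hG : HasFiniteBalls G) (hg : g ∈ G)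
    (M : ℝ) : ∃ F : Set SL(2, ℝ), F.Finite ∧ F ⊆ G ∧
      ∀ A ∈ G, ‖A.1 *ᵥ e‖ * ‖A.1 *ᵥ f‖ ≤ M → ∃ j : ℤ, A * g ^ j ∈ F := by
  refine ⟨_, hG.finite_of_norm_le h.cross_ne (max l M), fun A hA => hA.1, fun A hA hM => ?_⟩
  have hl := h.pos
  -- With `l ^ j ≤ ‖A e‖ < l ^ (j + 1)`, the element `A g⁻ʲ` sends `e` to a vector of norm below
  -- `l`, while `‖A g⁻ʲ f‖ = l ^ j * ‖A f‖` is at most the product bounded by `M`.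
  obtain ⟨j, hj1, hj2⟩ := exists_mem_Ico_zpow (norm_pos_iff.2 (mulVec_ne_zero A h.left_ne))
    h.one_lt
  have hlj : 0 < l ^ j := zpow_pos hl j
  refine ⟨-j, G.mul_mem hA (G.zpow_mem hg _), le_max_of_le_left ?_, le_max_of_le_right ?_⟩
  · rw [mul_mulVec, h.zpow_left, mulVec_smul, norm_smul, Real.norm_of_nonneg (by positivity),
      _root_.zpow_neg, inv_mul_le_iff₀ hlj, ← zpow_add_one₀ hl.ne']
    exact hj2.le
  · rw [mul_mulVec, h.zpow_right, mulVec_smul, norm_smul, Real.norm_of_nonneg (by positivity),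
      neg_neg]
    exact (mul_le_mul_of_nonneg_right hj1 (norm_nonneg _)).trans hM

/-- A vector whose orbit does not accumulate at the origin is not an eigenvector. -/
theorem coord_ne_zero (h : IsEigenbasis g l e f) (hg : g ∈ G) {a b : ℝ}
    (hv : ∃ ε > 0, ∀ A ∈ G, ε ≤ ‖A.1 *ᵥ (a • e + b • f)‖) : b ≠ 0 := by
  rintro rfl
  obtain ⟨ε, hε, hv⟩ := hv
  -- If `b = 0`, the vectors `g⁻ⁿ v = l⁻ⁿ a e` tend to the origin.
  have h1 : Tendsto (fun n : ℕ => (l⁻¹) ^ n * ‖a • e‖) atTop (𝓝 (0 * ‖a • e‖)) :=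
    (tendsto_pow_atTop_nhds_zero_of_lt_one (inv_nonneg.2 h.pos.le)
      (inv_lt_one_of_one_lt₀ h.one_lt)).mul_const _
  rw [zero_mul] at h1
  obtain ⟨n, hn⟩ := (h1.eventually (gt_mem_nhds hε)).exists
  have h2 := hv (g ^ (-(n : ℤ))) (G.zpow_mem hg _)
  rw [h.zpow_coords] at h2
  have hl := h.pos
  have e1 : ‖(a * l ^ (-(n : ℤ))) • e + (0 * l ^ (- -(n : ℤ))) • f‖ = (l⁻¹) ^ n * ‖a • e‖ := by
    rw [zero_mul, zero_smul, add_zero, mul_comm, mul_smul, norm_smul,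
      Real.norm_of_nonneg (by positivity), _root_.zpow_neg, zpow_natCast, inv_pow]
  rw [e1] at h2
  linarith

theorem coord_ne_zero' (h : IsEigenbasis g l e f) (hg : g ∈ G) {a b : ℝ}
    (hv : ∃ ε > 0, ∀ A ∈ G, ε ≤ ‖A.1 *ᵥ (a • e + b • f)‖) : a ≠ 0 := by
  rw [add_comm] at hv
  exact h.symm.coord_ne_zero (G.inv_mem hg) hv

/-- A translate of the geodesic from `g⁻ⁿ v` to `gⁿ w` in a bounded set either comes from the end
near `g⁻ⁿ v`, which happens finitely often, or is close to a translate of the axis. -/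
theorem exists_finite_end (h : IsEigenbasis g l e f) (hG : HasFiniteBalls G) (hg : g ∈ G)
    {a b c d : ℝ} (hv : ∃ ε > 0, ∀ A ∈ G, ε ≤ ‖A.1 *ᵥ (a • e + b • f)‖) (hc : c ≠ 0) (M : ℝ) :
    ∃ E : Set SL(2, ℝ), E.Finite ∧ ∃ N : ℕ, ∀ n ≥ N, ∀ A ∈ G,
      ‖(A * g ^ (-(n : ℤ))).1 *ᵥ (a • e + b • f)‖ * ‖(A * g ^ (n : ℤ)).1 *ᵥ (c • e + d • f)‖
        ≤ M * (l ^ n) ^ 2 →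
      A * g ^ (-(n : ℤ)) ∈ E ∨ 2 * |a| * ‖(A * g ^ (-(n : ℤ))).1 *ᵥ e‖
        ≤ |b| * ‖(A * g ^ (-(n : ℤ))).1 *ᵥ f‖ := by
  have hb := h.coord_ne_zero hg hv
  obtain ⟨ε, hε, hv⟩ := hv
  have hb' := abs_pos.2 hb
  have hc' := abs_pos.2 hc
  have hl := h.pos
  -- If the second alternative fails, then `‖B f‖ ≤ C ‖B e‖` for `B = A g⁻ⁿ`. So it suffices to
  -- bound `‖B e‖`, and `X` is the bound obtained.
  set C := 2 * |a| / |b| with hC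
  have hC0 : 0 ≤ C := by positivity
  set X := 2 * M / (|c| * ε)
  -- For `n ≥ N` the `f`-part of `B g²ⁿ w` is at most half of its `e`-part, given `‖B f‖ ≤ C ‖B e‖`.
  obtain ⟨N, hN⟩ := pow_unbounded_of_one_lt (2 * |d| * C / |c|) h.one_lt
  refine ⟨_, hG.finite_of_norm_le h.cross_ne (max X (C * X)), N, fun n hn A hA hM => ?_⟩
  by_contra! hcon
  obtain ⟨hE, hlt⟩ := hcon
  set B := A * g ^ (-(n : ℤ)) with hB
  have hBG : B ∈ G := G.mul_mem hA (G.zpow_mem hg _)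
  have hAB : A * g ^ (n : ℤ) = B * g ^ (2 * n : ℤ) := by
    rw [hB, mul_assoc, ← _root_.zpow_add]; congr 2; ring
  set x := ‖B.1 *ᵥ e‖ with hx
  set y := ‖B.1 *ᵥ f‖ with hy
  have hx0 : 0 ≤ x := norm_nonneg _
  have hy0 : 0 ≤ y := norm_nonneg _
  have hyx : y ≤ C * x := by
    rw [hC, div_mul_eq_mul_div, le_div_iff₀ hb', mul_comm y]
    exact hlt.le
  set μ := l ^ n with hμ
  have hμ1 : 1 ≤ μ := one_le_pow₀ h.one_lt.le
  have hμN : 2 * |d| * C / |c| ≤ μ := hN.le.trans (pow_le_pow_right₀ h.one_lt.le hn)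
  have hlow : |c| / 2 * μ ^ 2 * x ≤ ‖(B * g ^ (2 * n : ℤ)).1 *ᵥ (c • e + d • f)‖ := by
    have e1 : (B * g ^ (2 * n : ℤ)).1 *ᵥ (c • e + d • f)
        = (c * μ ^ 2) • (B.1 *ᵥ e) + (d * (μ ^ 2)⁻¹) • (B.1 *ᵥ f) := by
      rw [mul_mulVec, h.zpow_coords, mulVec_add, mulVec_smul, mulVec_smul]
      have : l ^ (2 * n : ℤ) = μ ^ 2 := by rw [hμ, ← pow_mul, mul_comm n]; norm_cast
      rw [_root_.zpow_neg, this]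
    rw [e1]
    have e2 := norm_sub_le_norm_add ((c * μ ^ 2) • (B.1 *ᵥ e)) ((d * (μ ^ 2)⁻¹) • (B.1 *ᵥ f))
    rw [norm_smul, norm_smul, ← hx, ← hy, norm_mul, norm_mul, norm_inv,
      Real.norm_of_nonneg (by positivity : 0 ≤ μ ^ 2), Real.norm_eq_abs, Real.norm_eq_abs] at e2
    have e3 : |d| * (μ ^ 2)⁻¹ * y ≤ |c| / 2 * μ ^ 2 * x := by
      rw [div_le_iff₀ hc'] at hμN
      calc |d| * (μ ^ 2)⁻¹ * y ≤ |d| * 1 * (C * x) := by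
            gcongr
            exact inv_le_one_of_one_le₀ (one_le_pow₀ hμ1)
        _ = (2 * |d| * C) / 2 * x := by ring
        _ ≤ (μ * |c|) / 2 * x := by gcongr
        _ = |c| / 2 * μ ^ 1 * x := by ring
        _ ≤ |c| / 2 * μ ^ 2 * x := by gcongr <;> norm_num
    linarith
  rw [hAB] at hM
  have hxX : x ≤ X := by
    have h1 : ε * (|c| / 2 * μ ^ 2 * x) ≤ M * μ ^ 2 :=
      (mul_le_mul (hv B hBG) hlow (by positivity) (norm_nonneg _)).trans hM
    have h2 : (|c| * ε * x) * μ ^ 2 ≤ (2 * M) * μ ^ 2 := by linarith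
    have h3 := le_of_mul_le_mul_right h2 (by positivity)
    rw [le_div_iff₀ (by positivity)]
    linarith
  exact hE ⟨hBG, le_max_of_le_left hxX,
    le_max_of_le_right (hyx.trans (mul_le_mul_of_nonneg_left hxX hC0))⟩

/-- The translates of the geodesic from `g⁻ⁿ v` to `gⁿ w` in a bounded set. -/
theorem exists_finite_ends (h : IsEigenbasis g l e f) (hG : HasFiniteBalls G) (hg : g ∈ G)
    {v w : Fin 2 → ℝ} (hv : ∃ ε > 0, ∀ A ∈ G, ε ≤ ‖A.1 *ᵥ v‖)
    (hw : ∃ ε > 0, ∀ A ∈ G, ε ≤ ‖A.1 *ᵥ w‖) (M : ℝ) :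
    ∃ E F : Set SL(2, ℝ), E.Finite ∧ F.Finite ∧ F ⊆ G ∧ ∃ N J : ℕ, ∀ n ≥ N, ∀ A ∈ G,
      ‖(A * g ^ (-(n : ℤ))).1 *ᵥ v‖ * ‖(A * g ^ (n : ℤ)).1 *ᵥ w‖ ≤ M * (l ^ n) ^ 2 →
      A * g ^ (-(n : ℤ)) ∈ E ∨ A * g ^ (n : ℤ) ∈ E ∨
        ∃ j : ℤ, |j| ≤ n + J ∧ A * g ^ j ∈ F := by
  obtain ⟨a, b, rfl⟩ := h.exists_coords v
  obtain ⟨c, d, rfl⟩ := h.exists_coords w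
  have ha := h.coord_ne_zero' hg hv
  have hb := h.coord_ne_zero hg hv
  have hc := h.coord_ne_zero' hg hw
  have hd := h.coord_ne_zero hg hw
  have hl := h.pos
  obtain ⟨E₁, hE₁, N₁, h₁⟩ := h.exists_finite_end hG hg (d := d) hv hc M
  rw [add_comm (c • e)] at hw
  -- The other end is the same statement for `g⁻¹`, which exchanges `e` with `f` and `v` with `w`.
  obtain ⟨E₂, hE₂, N₂, h₂⟩ := h.symm.exists_finite_end hG (G.inv_mem hg) (d := a) hw hb M
  -- The factor 4 comes from the lower bounds `hlow₁` and `hlow₂`, each of which loses a factor 2.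
  obtain ⟨F, hF, hFG, hFM⟩ := h.exists_finite_cosets hG hg (4 * M / (|b| * |c|))
  -- Write `A = k g⁻ʲ` with `k` in `F`. The two domination inequalities compare powers of `l` with
  -- the ratios below, and these are bounded because `F` is finite.
  obtain ⟨R, hR⟩ := (hF.image fun k => max (|b| * ‖k.1 *ᵥ f‖ / (2 * |a| * ‖k.1 *ᵥ e‖))
    (|c| * ‖k.1 *ᵥ e‖ / (2 * |d| * ‖k.1 *ᵥ f‖))).bddAbove
  obtain ⟨J, hJ⟩ := pow_unbounded_of_one_lt R h.one_lt
  refine ⟨E₁ ∪ E₂, F, hE₁.union hE₂, hF, hFG, max N₁ N₂, J, fun n hn A hA hM => ?_⟩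
  have h₁' := h₁ n (le_of_max_le_left hn) A hA hM
  have h₂' := h₂ n (le_of_max_le_right hn) A hA (by
    simp only [_root_.inv_zpow', neg_neg]
    rw [mul_comm, add_comm (b • f), add_comm (d • f)]
    exact hM)
  simp only [_root_.inv_zpow', neg_neg] at h₂'
  rcases h₁' with h₁' | h₁'
  · exact Or.inl (Or.inl h₁')
  rcases h₂' with h₂' | h₂'
  · exact Or.inr (Or.inl (Or.inr h₂'))
  refine Or.inr (Or.inr ?_)
  have nl : ∀ (B : SL(2, ℝ)) (m : ℤ), ‖(B * g ^ m).1 *ᵥ e‖ = l ^ m * ‖B.1 *ᵥ e‖ := by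
    intro B m
    rw [mul_mulVec, h.zpow_left, mulVec_smul, norm_smul, Real.norm_of_nonneg (by positivity)]
  have nr : ∀ (B : SL(2, ℝ)) (m : ℤ), ‖(B * g ^ m).1 *ᵥ f‖ = l ^ (-m) * ‖B.1 *ᵥ f‖ := by
    intro B m
    rw [mul_mulVec, h.zpow_right, mulVec_smul, norm_smul, Real.norm_of_nonneg (by positivity)]
  -- Where the `f`-part is at least twice the `e`-part, half of it survives in the norm of the sum.
  have hlow₁ : |b| / 2 * ‖(A * g ^ (-(n : ℤ))).1 *ᵥ f‖
      ≤ ‖(A * g ^ (-(n : ℤ))).1 *ᵥ (a • e + b • f)‖ := by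
    have := norm_sub_le_norm_add ((b • (A * g ^ (-(n : ℤ))).1 *ᵥ f))
      (a • ((A * g ^ (-(n : ℤ))).1 *ᵥ e))
    rw [norm_smul, norm_smul, Real.norm_eq_abs, Real.norm_eq_abs] at this
    rw [mulVec_add, mulVec_smul, mulVec_smul, add_comm]
    linarith
  have hlow₂ : |c| / 2 * ‖(A * g ^ (n : ℤ)).1 *ᵥ e‖
      ≤ ‖(A * g ^ (n : ℤ)).1 *ᵥ (c • e + d • f)‖ := by
    have := norm_sub_le_norm_add ((c • (A * g ^ (n : ℤ)).1 *ᵥ e))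
      (d • ((A * g ^ (n : ℤ)).1 *ᵥ f))
    rw [norm_smul, norm_smul, Real.norm_eq_abs, Real.norm_eq_abs] at this
    rw [mulVec_add, mulVec_smul, mulVec_smul]
    linarith
  have hb' := abs_pos.2 hb
  have hc' := abs_pos.2 hc
  have ha' := abs_pos.2 ha
  have hd' := abs_pos.2 hd
  obtain ⟨j, hj⟩ := hFM A hA (by
    have := (mul_le_mul hlow₁ hlow₂ (by positivity) (norm_nonneg _)).trans hM
    rw [nl, nr, neg_neg, zpow_natCast] at this
    have h2 : (‖A.1 *ᵥ e‖ * ‖A.1 *ᵥ f‖ * (|b| * |c|)) * (l ^ n) ^ 2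
        ≤ (4 * M) * (l ^ n) ^ 2 := by linarith
    rw [le_div_iff₀ (by positivity)]
    exact le_of_mul_le_mul_right h2 (by positivity))
  refine ⟨j, ?_, hj⟩
  set k := A * g ^ j with hk
  have hAk : ∀ m : ℤ, A * g ^ m = k * g ^ (m - j) := by
    intro m
    rw [hk, mul_assoc, ← _root_.zpow_add]; congr 2; ring
  have hke : 0 < ‖k.1 *ᵥ e‖ := norm_pos_iff.2 (mulVec_ne_zero k h.left_ne)
  have hkf : 0 < ‖k.1 *ᵥ f‖ := norm_pos_iff.2 (mulVec_ne_zero k h.right_ne)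
  have hRk := hR ⟨k, hj, rfl⟩
  -- If `-m > J`, then `l ^ m ≤ 1`, so `l ^ (-m) ≤ t / s ≤ R < l ^ J`, a contradiction. Used with `m
  -- = n + j` and `m = n - j`, this gives `|j| ≤ n + J`.
  have fin : ∀ (m : ℤ) (s t : ℝ), 0 < s → s * l ^ (-m) ≤ t * l ^ m → t / s ≤ R → -m ≤ J := by
    intro m s t hs hst htR
    by_contra! hlt
    have hm : (1 : ℝ) ≤ l ^ (-m) := one_le_zpow₀ h.one_lt.le (by omega)
    have h1 : l ^ (-m) ≤ t / s := by
      rw [le_div_iff₀ hs]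
      have h3 : l ^ (-m) * l ^ m = 1 := by rw [← zpow_add₀ hl.ne']; simp
      have hm' : 0 < l ^ m := zpow_pos hl m
      have h4 : l ^ m ≤ 1 := by nlinarith
      have ht : 0 ≤ t := by
        by_contra! ht
        nlinarith [mul_pos hs (zpow_pos hl (-m)), mul_pos (neg_pos.2 ht) hm']
      nlinarith
    have h2 : l ^ (J : ℤ) ≤ l ^ (-m) := zpow_le_zpow_right₀ h.one_lt.le hlt.le
    rw [zpow_natCast] at h2
    linarith
  rw [hAk, nl, nr] at h₁' h₂'
  have f₁ := fin (n + j) (2 * |a| * ‖k.1 *ᵥ e‖) (|b| * ‖k.1 *ᵥ f‖) (by positivity) (by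
    have e1 : -((n : ℤ) + j) = -n - j := by ring
    have e2 : (n : ℤ) + j = -(-n - j) := by ring
    rw [e1]; rw [e2]; linarith) ((le_max_left _ _).trans hRk)
  have f₂ := fin (n - j) (2 * |d| * ‖k.1 *ᵥ f‖) (|c| * ‖k.1 *ᵥ e‖) (by positivity) (by
    linarith) ((le_max_right _ _).trans hRk)
  rw [abs_le]
  constructor <;> omega

end IsEigenbasis

/-! ### Convergence to the boundary circle -/

theorem circleToSphere_toLine (v : Fin 2 → ℝ) :
    circleToSphere (toLine v) = sphereDiv ((v 0 : ℂ), (v 1 : ℂ)) := by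
  unfold toLine sphereDiv
  by_cases h : v 1 = 0
  · simp only [h, if_true, Complex.ofReal_zero]
    rfl
  · have h' : (v 1 : ℂ) ≠ 0 := by exact_mod_cast h
    simp only [h, h', if_false]
    change (((v 0 / v 1 : ℝ) : ℂ) : OnePoint ℂ) = _
    push_cast
    rfl

theorem injective_circleToSphere : Function.Injective circleToSphere := by
  intro ξ η h
  cases ξ <;> cases η <;> simp_all [circleToSphere]

theorem planeToSphere_ne_circleToSphere (z : ℍ) (ξ : OnePoint ℝ) :
    planeToSphere z ≠ circleToSphere ξ := by
  intro h
  cases ξ with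
  | infty => simp [circleToSphere, planeToSphere] at h
  | coe t =>
    simp only [circleToSphere, planeToSphere, OnePoint.map_some, OnePoint.coe_eq_coe] at h
    have := congrArg Complex.im h
    simp at this
    exact z.im_pos.ne' this

theorem sphereDiv_mul {c : ℂ} (hc : c ≠ 0) (x y : ℂ) :
    sphereDiv (c * x, c * y) = sphereDiv (x, y) := by
  simp [sphereDiv, hc, mul_div_mul_left]

/-- The homogeneous coordinates `(z, 1)` split as `(Re z, 1) + i (Im z, 0)`, so the action on the
plane reduces to that on two real vectors. -/
theorem planeToSphere_smul_eq (A : SL(2, ℝ)) (z : ℍ) :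
    planeToSphere (A • z) = sphereDiv
      (((A.1 *ᵥ ![z.re, 1]) 0 : ℂ) + ((A.1 *ᵥ ![z.im, 0]) 0 : ℂ) * Complex.I,
        ((A.1 *ᵥ ![z.re, 1]) 1 : ℂ) + ((A.1 *ᵥ ![z.im, 0]) 1 : ℂ) * Complex.I) := by
  have hz : (z : ℂ) = (z.re : ℂ) + (z.im : ℂ) * Complex.I := by
    apply Complex.ext <;> simp
  have e0 : ((A.1 *ᵥ ![z.re, 1]) 0 : ℂ) + ((A.1 *ᵥ ![z.im, 0]) 0 : ℂ) * Complex.I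
      = A.1 0 0 * z + A.1 0 1 := by
    rw [hz]; simp only [mulVec_fin_two]; simp; ring
  have e1 : ((A.1 *ᵥ ![z.re, 1]) 1 : ℂ) + ((A.1 *ᵥ ![z.im, 0]) 1 : ℂ) * Complex.I
      = A.1 1 0 * z + A.1 1 1 := by
    rw [hz]; simp only [mulVec_fin_two]; simp; ring
  have hden : (A.1 1 0 : ℂ) * z + A.1 1 1 ≠ 0 := UpperHalfPlane.denom_ne_zero (A : GL (Fin 2) ℝ) z
  rw [e0, e1, planeToSphere, UpperHalfPlane.coe_specialLinearGroup_apply]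
  simp only [sphereDiv, hden, if_false]
  rfl

/-- After rescaling, the complex homogeneous coordinates converge to `(α + iβ) v`. This is a nonzero
complex multiple of a real vector, hence a point of the boundary circle. -/
theorem tendsto_planeToSphere {ι : Type*} {F : Filter ι} {A : ι → SL(2, ℝ)} {c : ι → ℝ} {z : ℍ}
    {v : Fin 2 → ℝ} (hv : v ≠ 0) (hc : ∀ᶠ i in F, c i ≠ 0) {α β : ℝ} (hαβ : α ≠ 0 ∨ β ≠ 0)
    (h1 : Tendsto (fun i => c i • (A i).1 *ᵥ ![z.re, 1]) F (𝓝 (α • v)))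
    (h2 : Tendsto (fun i => c i • (A i).1 *ᵥ ![z.im, 0]) F (𝓝 (β • v))) :
    Tendsto (fun i => planeToSphere (A i • z)) F (𝓝 (circleToSphere (toLine v))) := by
  have hne : (α : ℂ) + β * Complex.I ≠ 0 := by
    intro h
    have h0 := congrArg Complex.re h
    have h1 := congrArg Complex.im h
    simp at h0 h1
    tauto
  have hlim : circleToSphere (toLine v) = sphereDiv
      (((α • v) 0 : ℝ) + ((β • v) 0 : ℝ) * Complex.I,
        ((α • v) 1 : ℝ) + ((β • v) 1 : ℝ) * Complex.I) := by
    rw [circleToSphere_toLine, ← sphereDiv_mul hne]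
    congr 2 <;> simp <;> ring
  rw [hlim]
  have hcont : ContinuousAt sphereDiv
      (((α • v) 0 : ℝ) + ((β • v) 0 : ℝ) * Complex.I,
        ((α • v) 1 : ℝ) + ((β • v) 1 : ℝ) * Complex.I) := by
    apply continuousAt_sphereDiv
    have e : ∀ i, (((α • v) i : ℝ) : ℂ) + ((β • v) i : ℝ) * Complex.I
        = (α + β * Complex.I) * (v i : ℝ) := by
      intro i; simp; ring
    rw [e, e]
    rw [ne_zero_iff_fin_two] at hv
    simpa [hne] using hv
  have ht : ∀ (u : ι → Fin 2 → ℝ) (y : Fin 2 → ℝ) (j : Fin 2), Tendsto u F (𝓝 y) →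
      Tendsto (fun i => ((u i j : ℝ) : ℂ)) F (𝓝 ((y j : ℝ) : ℂ)) := fun u y j hu =>
    (Complex.continuous_ofReal.tendsto _).comp (tendsto_pi_nhds.1 hu j)
  have hpair := ((ht _ _ 0 h1).add ((ht _ _ 0 h2).mul_const Complex.I)).prodMk_nhds
    ((ht _ _ 1 h1).add ((ht _ _ 1 h2).mul_const Complex.I))
  refine (hcont.tendsto.comp hpair).congr' ?_
  filter_upwards [hc] with i hi
  have hi' : (c i : ℂ) ≠ 0 := by exact_mod_cast hi
  rw [planeToSphere_smul_eq, ← sphereDiv_mul hi', Function.comp_apply]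
  congr 2 <;> simp <;> ring

theorem IsEigenbasis.tendsto_smul_zpow_mulVec {g : SL(2, ℝ)} {l : ℝ} {e f : Fin 2 → ℝ}
    (h : IsEigenbasis g l e f) (a b : ℝ) :
    Tendsto (fun n : ℕ => l ^ (-(n : ℤ)) • (g ^ (n : ℤ)).1 *ᵥ (a • e + b • f)) atTop
      (𝓝 (a • e)) := by
  have hl := h.pos
  have h1 : Tendsto (fun n : ℕ => a • e + (((l⁻¹) ^ n * (l⁻¹) ^ n) * b) • f) atTop
      (𝓝 (a • e + ((0 * 0) * b) • f)) := by
    have := tendsto_pow_atTop_nhds_zero_of_lt_one (inv_nonneg.2 hl.le)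
      (inv_lt_one_of_one_lt₀ h.one_lt)
    exact (((this.mul this).mul_const b).smul_const f).const_add _
  simp only [mul_zero, zero_mul, zero_smul, add_zero] at h1
  refine h1.congr fun n => ?_
  have hln : l ^ n ≠ 0 := (pow_pos hl n).ne'
  rw [h.zpow_coords, smul_add, smul_smul, smul_smul, _root_.zpow_neg, zpow_natCast, inv_pow]
  congr 2
  · field_simp
  · ring

theorem IsEigenbasis.tendsto_toLine {g : SL(2, ℝ)} {l : ℝ} {e f : Fin 2 → ℝ}
    (h : IsEigenbasis g l e f) {a b : ℝ} (ha : a ≠ 0) :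
    Tendsto (fun n : ℕ => toLine ((g ^ (n : ℤ)).1 *ᵥ (a • e + b • f))) atTop
      (𝓝 (toLine e)) := by
  have hl := h.pos
  have hv : a • e + b • f ≠ 0 := by
    intro h0
    have h1 : cross (a • e + b • f) f = a * cross e f := by simp [cross]; ring
    rw [h0] at h1
    exact mul_ne_zero ha h.cross_ne (by rw [← h1]; simp [cross])
  rw [← toLine_smul ha]
  refine (CuspedSurface.tendsto_toLine (Eventually.of_forall fun n => ?_) (smul_ne_zero ha h.left_ne)
    (h.tendsto_smul_zpow_mulVec a b)).congr fun n => toLine_smul (zpow_pos hl _).ne' _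
  exact smul_ne_zero (zpow_pos hl _).ne' (mulVec_ne_zero _ hv)

theorem IsEigenbasis.tendsto_planeToSphere {g : SL(2, ℝ)} {l : ℝ} {e f : Fin 2 → ℝ}
    (h : IsEigenbasis g l e f) (z : ℍ) :
    Tendsto (fun n : ℕ => planeToSphere (g ^ (n : ℤ) • z)) atTop
      (𝓝 (circleToSphere (toLine e))) := by
  obtain ⟨a, b, hab⟩ := h.exists_coords ![z.re, 1]
  obtain ⟨a', b', hab'⟩ := h.exists_coords ![z.im, 0]
  refine CuspedSurface.tendsto_planeToSphere (c := fun n : ℕ => l ^ (-(n : ℤ))) (α := a) (β := a')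
    h.left_ne (Eventually.of_forall fun n => (zpow_pos h.pos _).ne') ?_ ?_ ?_
  -- If both `e`-coordinates vanished, the two vectors would be parallel to `f`; but their
  -- determinant is `-Im z`.
  · by_contra! hcon
    rw [hcon.1, zero_smul, zero_add] at hab
    rw [hcon.2, zero_smul, zero_add] at hab'
    have h1 : cross ![z.re, 1] ![z.im, 0] = 0 := by
      rw [hab, hab', cross_smul_left, cross_smul_right]
      simp [cross, mul_comm]
    simp [cross] at h1
    exact z.im_pos.ne' h1
  · rw [hab]; exact h.tendsto_smul_zpow_mulVec a b
  · rw [hab']; exact h.tendsto_smul_zpow_mulVec a' b'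

/-- Here `tⁿ u = u + n s (cross v u) v`, so division by `n` leaves a multiple of `v`. -/
theorem tendsto_planeToSphere_of_fixed {t : SL(2, ℝ)} (ht1 : t ≠ 1) {v : Fin 2 → ℝ} (hv : v ≠ 0)
    (ht : t.1 *ᵥ v = v) (z : ℍ) :
    Tendsto (fun n : ℕ => planeToSphere (t ^ n • z)) atTop
      (𝓝 (circleToSphere (toLine v))) := by
  obtain ⟨s, hs⟩ := exists_transvection hv ht
  have hs0 : s ≠ 0 := by
    rintro rfl
    exact ht1 (Subtype.ext (by simpa using hs))
  have hone : ∀ u, t.1 *ᵥ u = u + (s * cross v u) • v := by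
    intro u
    rw [hs]
    ext i
    rw [mulVec_fin_two]
    fin_cases i <;> simp [cross] <;> ring
  have hpow : ∀ (n : ℕ) u, (t ^ n).1 *ᵥ u = u + (n * (s * cross v u)) • v := by
    intro n u
    induction n with
    | zero => simp
    | succ n ih =>
      rw [pow_succ', mul_mulVec, ih, mulVec_add, mulVec_smul, ht, hone]
      push_cast
      module
  have hlim : ∀ u, Tendsto (fun n : ℕ => ((n : ℝ)⁻¹) • (t ^ n).1 *ᵥ u) atTop
      (𝓝 ((s * cross v u) • v)) := by
    intro u
    have h1 : Tendsto (fun n : ℕ => ((n : ℝ)⁻¹) • u + (s * cross v u) • v) atTop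
        (𝓝 ((0 : ℝ) • u + (s * cross v u) • v)) :=
      (tendsto_inv_atTop_nhds_zero_nat.smul_const u).add_const _
    rw [zero_smul, zero_add] at h1
    refine h1.congr' ?_
    filter_upwards [eventually_gt_atTop 0] with n hn
    have : (n : ℝ) ≠ 0 := by positivity
    rw [hpow, smul_add, smul_smul, inv_mul_cancel_left₀ this]
  refine tendsto_planeToSphere (c := fun n : ℕ => (n : ℝ)⁻¹) hv ?_ ?_ (hlim _) (hlim _)
  · filter_upwards [eventually_gt_atTop 0] with n hn
    positivity
  · by_contra! hcon
    have h1 := (mul_eq_zero.1 hcon.1).resolve_left hs0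
    have h2 := (mul_eq_zero.1 hcon.2).resolve_left hs0
    have hz := z.im_pos.ne'
    simp [cross, hz] at h1 h2
    apply ne_zero_iff_fin_two.1 hv |>.elim <;> simp_all

/-! ### Matrices representing deck transformations -/

theorem eq_or_eq_neg_of_toPGL_eq {A B : SL(2, ℝ)}
    (h : SpecialLinearGroup.toPGL A = SpecialLinearGroup.toPGL B) : B = A ∨ B = -A := by
  obtain ⟨u, hu⟩ := ProjGenLinGroup.mk_eq_mk_iff.1 h
  have hm : B.1 = (u : ℝ) • A.1 := by
    have := congrArg Units.val hu
    rw [Units.val_mul, GeneralLinearGroup.coe_scalar] at this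
    change A.1 * _ = B.1 at this
    rw [← this]
    ext i j
    simp [mul_comm]
  have hu2 : (u : ℝ) ^ 2 = 1 := by
    have h1 := det_eq_one_fin_two A
    have h2 := det_eq_one_fin_two B
    rw [hm] at h2
    simp at h2
    linear_combination h2 - (u : ℝ) ^ 2 * h1
  rcases sq_eq_one_iff.1 hu2 with h1 | h1
  · left; exact Subtype.ext (by rw [hm, h1, one_smul])
  · right; exact Subtype.ext (by rw [hm, h1, neg_one_smul]; rfl)

theorem toPGL_neg (A : SL(2, ℝ)) :
    SpecialLinearGroup.toPGL (-A) = SpecialLinearGroup.toPGL A := by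
  refine ProjGenLinGroup.mk_eq_mk_iff.2 ⟨-1, Units.ext ?_⟩
  rw [Units.val_mul, GeneralLinearGroup.coe_scalar]
  change (-A.1) * _ = A.1
  ext i j
  simp

theorem eigenvalue_eq {A : SL(2, ℝ)} {v : Fin 2 → ℝ} (hv : v ≠ 0) {c : ℝ}
    (h : A.1 *ᵥ v = c • v) : c ^ 2 - A.1.trace * c + 1 = 0 := by
  have h0 := congrFun h 0
  have h1 := congrFun h 1
  rw [mulVec_fin_two] at h0 h1
  simp only [Pi.smul_apply, smul_eq_mul] at h0 h1
  have hd := det_eq_one_fin_two A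
  rw [trace_fin_two]
  rcases ne_zero_iff_fin_two.1 hv with hv | hv
  · refine (mul_eq_zero.1 ?_).resolve_right hv
    linear_combination (A.1 1 1 - c) * h0 - A.1 0 1 * h1 - v 0 * hd
  · refine (mul_eq_zero.1 ?_).resolve_right hv
    linear_combination (A.1 0 0 - c) * h1 - A.1 1 0 * h0 - v 1 * hd

theorem exists_eigenvector {A : SL(2, ℝ)} {c : ℝ} (h : c ^ 2 - A.1.trace * c + 1 = 0) :
    ∃ v : Fin 2 → ℝ, v ≠ 0 ∧ A.1 *ᵥ v = c • v := by
  have hdet : (A.1 - c • (1 : Matrix (Fin 2) (Fin 2) ℝ)).det = 0 := by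
    rw [trace_fin_two] at h
    rw [det_fin_two]
    simp
    linear_combination h + det_eq_one_fin_two A
  obtain ⟨v, hv, hv2⟩ := Matrix.exists_mulVec_eq_zero_iff.2 hdet
  refine ⟨v, hv, ?_⟩
  rwa [sub_mulVec, sub_eq_zero, smul_mulVec, one_mulVec] at hv2

theorem exists_isEigenbasis {A : SL(2, ℝ)} (h : 2 < A.1.trace) :
    ∃ (l : ℝ) (e f : Fin 2 → ℝ), IsEigenbasis A l e f := by
  set τ := A.1.trace
  set r := √(τ ^ 2 - 4)
  have hr : r ^ 2 = τ ^ 2 - 4 := Real.sq_sqrt (by nlinarith)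
  have hr0 : 0 ≤ r := Real.sqrt_nonneg _
  -- The larger root of the characteristic polynomial; the other root is `l⁻¹` because the
  -- determinant is 1.
  set l := (τ + r) / 2 with hl
  have hl1 : 1 < l := by rw [hl]; linarith
  have hl0 : l ≠ 0 := by positivity
  have hlq : l ^ 2 - τ * l + 1 = 0 := by rw [hl]; linear_combination hr / 4
  have hlq' : (l⁻¹) ^ 2 - τ * l⁻¹ + 1 = 0 := by field_simp; linarith
  obtain ⟨e, he, he'⟩ := exists_eigenvector hlq
  obtain ⟨f, hf, hf'⟩ := exists_eigenvector hlq'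
  refine ⟨l, e, f, hl1, he', hf', fun hcr => ?_⟩
  obtain ⟨c, rfl⟩ := (cross_eq_zero_iff hf).1 hcr
  rw [mulVec_smul, hf', smul_comm, ← sub_eq_zero, ← sub_smul, smul_eq_zero] at he'
  have : l⁻¹ < 1 := inv_lt_one_of_one_lt₀ hl1
  rcases he' with h | h
  · linarith
  · exact he h

namespace HyperbolicSurface

variable (S : HyperbolicSurface)

/-- The matrices of determinant one that represent deck transformations. -/
def lifts : Subgroup SL(2, ℝ) := S.Γ.comap SpecialLinearGroup.toPGL

theorem exists_lift (γ : S.Γ) : ∃ A ∈ S.lifts, SpecialLinearGroup.toPGL A = (γ : PGL(2, ℝ)) := by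
  obtain ⟨A, hA⟩ := S.orientation γ.1 γ.2
  refine ⟨A, ?_, hA⟩
  change SpecialLinearGroup.toPGL A ∈ S.Γ
  rw [hA]
  exact γ.2

theorem neg_mem_lifts {A : SL(2, ℝ)} (hA : A ∈ S.lifts) : -A ∈ S.lifts := by
  change SpecialLinearGroup.toPGL (-A) ∈ S.Γ
  rw [toPGL_neg]
  exact hA

theorem toPGL_smul_plane (A : SL(2, ℝ)) (z : ℍ) : SpecialLinearGroup.toPGL A • z = A • z :=
  UpperHalfPlane.pglMk_smul _ z

theorem isCompact_entries_le (R : ℝ) :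
    IsCompact {A : SL(2, ℝ) | ∀ i j, |A.1 i j| ≤ R} := by
  have hemb : IsClosedEmbedding (Subtype.val : SL(2, ℝ) → Matrix (Fin 2) (Fin 2) ℝ) := by
    refine IsClosedEmbedding.mk IsEmbedding.subtypeVal ?_
    have : Set.range (Subtype.val : SL(2, ℝ) → Matrix (Fin 2) (Fin 2) ℝ)
        = {B : Matrix (Fin 2) (Fin 2) ℝ | B.det = 1} := Subtype.range_val
    rw [this]
    exact isClosed_eq (Continuous.matrix_det continuous_id) continuous_const
  have hK : IsCompact (Set.pi Set.univ fun _ : Fin 2 => Set.pi Set.univ fun _ : Fin 2 =>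
      Set.Icc (-R) R) :=
    isCompact_univ_pi fun _ => isCompact_univ_pi fun _ => isCompact_Icc
  refine (hemb.isCompact_preimage hK).of_isClosed_subset ?_ fun A hA i _ j _ => abs_le.1 (hA i j)
  simp only [Set.ofPred_forall]
  exact isClosed_iInter fun i => isClosed_iInter fun j => isClosed_le
    (continuous_abs.comp (hemb.continuous.matrix_elem i j)) continuous_const

/-- Matrices with bounded entries move the point `i` within a compact set, so proper discontinuity
leaves finitely many deck transformations, each with at most two lifts. -/
theorem hasFiniteBalls_lifts : HasFiniteBalls S.lifts := by
  intro R
  have hK : IsCompact ((fun A : SL(2, ℝ) => A • UpperHalfPlane.I) ''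
      {A : SL(2, ℝ) | ∀ i j, |A.1 i j| ≤ R}) :=
    (isCompact_entries_le R).image (by fun_prop)
  have hfin := S.properlyDiscontinuous.finite_disjoint_inter_image
    (isCompact_singleton (x := UpperHalfPlane.I)) hK
  have hfin2 := hfin.image (Subtype.val : S.Γ → PGL(2, ℝ))
  refine (hfin2.preimage' (f := (SpecialLinearGroup.toPGL : SL(2, ℝ) →* PGL(2, ℝ)))
    fun γ _ => ?_).subset ?_
  · by_cases h : ∃ A, SpecialLinearGroup.toPGL A = γ
    · obtain ⟨A, rfl⟩ := h
      refine (Set.toFinite {A, -A}).subset fun B hB => ?_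
      exact eq_or_eq_neg_of_toPGL_eq (Eq.symm hB)
    · refine Set.finite_empty.subset fun B hB => h ⟨B, hB⟩
  · rintro A ⟨hA, hR⟩
    refine ⟨⟨SpecialLinearGroup.toPGL A, hA⟩, ?_, rfl⟩
    refine ⟨A • UpperHalfPlane.I, ⟨UpperHalfPlane.I, rfl, ?_⟩, ⟨A, hR, rfl⟩⟩
    exact toPGL_smul_plane A _

theorem trace_sq_of_isParabolicIsom {A : SL(2, ℝ)}
    (h : IsParabolicIsom (SpecialLinearGroup.toPGL A)) :
    A.1.trace ^ 2 = 4 ∧ A ≠ 1 ∧ A ≠ -1 := by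
  obtain ⟨B, hB, hB1, hB2⟩ := h
  obtain ⟨u, hu⟩ := ProjGenLinGroup.mk_eq_mk_iff.1 hB
  have hm : A.1 = (u : ℝ) • B.1 := by
    have := congrArg Units.val hu
    rw [Units.val_mul, GeneralLinearGroup.coe_scalar] at this
    change _ = A.1 at this
    rw [← this]
    ext i j
    simp [mul_comm]
  have hu0 : (u : ℝ) ≠ 0 := u.ne_zero
  have hns : ∀ c : ℝ, A.1 ≠ c • (1 : Matrix (Fin 2) (Fin 2) ℝ) := by
    intro c hc
    refine hB1 ⟨(u : ℝ)⁻¹ * c, ?_⟩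
    rw [hm] at hc
    have : B.1 = (u : ℝ)⁻¹ • (c • (1 : Matrix (Fin 2) (Fin 2) ℝ)) := by
      rw [← hc, smul_smul, inv_mul_cancel₀ hu0, one_smul]
    rw [this, smul_smul]
    ext i j
    simp [Matrix.diagonal_apply, Matrix.one_apply]
  refine ⟨?_, ?_, ?_⟩
  · have hd := A.2
    rw [hm, det_smul] at hd
    rw [discr_fin_two] at hB2
    rw [hm, trace_smul]
    simp at hd ⊢
    linear_combination (u : ℝ) ^ 2 * hB2 + 4 * hd
  · rintro rfl
    exact hns 1 (by rw [one_smul]; rfl)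
  · rintro rfl
    exact hns (-1) (by rw [neg_one_smul]; rfl)

theorem exists_isEigenbasis_lift (g : S.Γ) (hg : IsHyperbolicIsom (g : PGL(2, ℝ))) :
    ∃ A ∈ S.lifts, SpecialLinearGroup.toPGL A = (g : PGL(2, ℝ)) ∧
      ∃ (l : ℝ) (e f : Fin 2 → ℝ), IsEigenbasis A l e f := by
  obtain ⟨A, hA, hAg⟩ := S.exists_lift g
  obtain ⟨B, hB, hB2⟩ := hg
  rw [← hAg] at hB
  obtain ⟨u, hu⟩ := ProjGenLinGroup.mk_eq_mk_iff.1 hB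
  have hm : A.1 = (u : ℝ) • B.1 := by
    have := congrArg Units.val hu
    rw [Units.val_mul, GeneralLinearGroup.coe_scalar] at this
    change _ = A.1 at this
    rw [← this]
    ext i j
    simp [mul_comm]
  have hu0 : (u : ℝ) ≠ 0 := u.ne_zero
  have htr : 4 < A.1.trace ^ 2 := by
    have hd := A.2
    rw [hm, det_smul] at hd
    have hB3 : 0 < B.1.trace ^ 2 - 4 * B.1.det := by
      have := hB2
      rwa [GeneralLinearGroup.IsHyperbolic, Matrix.IsHyperbolic, discr_fin_two] at this
    have := mul_pos (by positivity : 0 < (u : ℝ) ^ 2) hB3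
    rw [hm, trace_smul]
    simp at hd ⊢
    nlinarith
  -- Of the two lifts, take the one of positive trace, so that the eigenvalues are positive.
  rcases lt_or_ge 0 A.1.trace with h | h
  · exact ⟨A, hA, hAg, exists_isEigenbasis (by nlinarith)⟩
  · refine ⟨-A, S.neg_mem_lifts hA, by rw [toPGL_neg, hAg], exists_isEigenbasis ?_⟩
    change 2 < (-A.1).trace
    rw [trace_neg]
    nlinarith

end HyperbolicSurface

/-! ### Continuity of the action on the boundary circle -/

theorem continuous_circleToSphere : Continuous circleToSphere := by
  refine OnePoint.continuous_map Complex.continuous_ofReal ?_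
  rw [coclosedCompact_eq_cocompact, coclosedCompact_eq_cocompact]
  exact Complex.isometry_ofReal.isClosedEmbedding.tendsto_cocompact

theorem isEmbedding_circleToSphere : IsEmbedding circleToSphere :=
  (continuous_circleToSphere.isClosedEmbedding injective_circleToSphere).isEmbedding

theorem continuous_toPGL_smul (A : SL(2, ℝ)) :
    Continuous fun ξ : OnePoint ℝ => SpecialLinearGroup.toPGL A • ξ := by
  rw [isEmbedding_circleToSphere.continuous_iff]
  refine ((continuous_smul_sphere ((A : GL (Fin 2) ℝ).map Complex.ofRealHom)).comp
    continuous_circleToSphere).congr fun ξ => ?_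
  rw [Function.comp_apply, ← circleToSphere_smul]
  exact congrArg circleToSphere (mk_smul_onePoint _ ξ).symm

namespace HyperbolicSurface

variable {S : HyperbolicSurface}

/-! ### Parabolic fixed points -/

/-- A parabolic lift has trace `±2`, so its eigenvalue on `v` is `±1`; a change of sign of the lift
makes `v` a fixed vector. -/
theorem exists_fixing_lift {A : SL(2, ℝ)} (hA : A ∈ S.lifts)
    (h : IsParabolicIsom (SpecialLinearGroup.toPGL A)) {v : Fin 2 → ℝ} (hv : v ≠ 0) {c : ℝ}
    (hc : A.1 *ᵥ v = c • v) :
    ∃ t ∈ S.lifts, t ≠ 1 ∧ t.1 *ᵥ v = v ∧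
      SpecialLinearGroup.toPGL t = SpecialLinearGroup.toPGL A := by
  obtain ⟨htr, h1, h2⟩ := trace_sq_of_isParabolicIsom h
  have hch := eigenvalue_eq hv hc
  have hc2 : c = 1 ∨ c = -1 := by
    have : (A.1.trace - 2) * (A.1.trace + 2) = 0 := by linear_combination htr
    rcases mul_eq_zero.1 this with h | h
    · left
      have e : A.1.trace = 2 := by linarith
      rw [e] at hch
      have : (c - 1) ^ 2 = 0 := by linear_combination hch
      linarith [pow_eq_zero_iff two_ne_zero |>.1 this]
    · right
      have e : A.1.trace = -2 := by linarith
      rw [e] at hch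
      have : (c + 1) ^ 2 = 0 := by linear_combination hch
      linarith [pow_eq_zero_iff two_ne_zero |>.1 this]
  rcases hc2 with rfl | rfl
  · exact ⟨A, hA, h1, by rwa [one_smul] at hc, rfl⟩
  · refine ⟨-A, S.neg_mem_lifts hA, fun h => h2 ?_, ?_, toPGL_neg A⟩
    · rw [← h, neg_neg]
    · change (-A.1) *ᵥ v = v
      rw [neg_mulVec, hc, neg_one_smul, neg_neg]

/-- Homogeneous coordinates of a boundary point whose orbit under the group of matrices does not
accumulate at the origin. -/
structure IsCuspVector (S : HyperbolicSurface) (v : Fin 2 → ℝ) (ξ : S.Boundary) : Prop where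
  ne_zero : v ≠ 0
  toLine_eq : toLine v = ξ.1
  exists_le : ∃ ε > 0, ∀ A ∈ S.lifts, ε ≤ ‖A.1 *ᵥ v‖

theorem IsParabolicPoint.exists_isCuspVector {ξ : S.Boundary} (h : S.IsParabolicPoint ξ) :
    ∃ v, S.IsCuspVector v ξ := by
  obtain ⟨γ, hγ, hfix⟩ := h
  obtain ⟨A, hA, hAγ⟩ := S.exists_lift γ
  obtain ⟨v, hv, hvξ⟩ := exists_toLine ξ.1
  have hfix' : SpecialLinearGroup.toPGL A • toLine v = toLine v := by
    rw [hAγ, hvξ]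
    exact congrArg Subtype.val hfix
  obtain ⟨c, hc⟩ := mulVec_eq_smul_of_fixed A hv hfix'
  obtain ⟨t, ht, ht1, htv, -⟩ := exists_fixing_lift hA (by rwa [hAγ]) hv hc
  exact ⟨v, hv, hvξ, S.hasFiniteBalls_lifts.exists_le_norm ht ht1 hv htv⟩

theorem mem_accumulationSet_of_tendsto {X : Set ℍ} {u : ℕ → ℍ} (hu : ∀ n, u n ∈ X)
    {ξ : OnePoint ℝ} (h : Tendsto (fun n => planeToSphere (u n)) atTop (𝓝 (circleToSphere ξ))) :
    ξ ∈ accumulationSet X :=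
  mem_closure_of_tendsto h (Eventually.of_forall fun n => ⟨u n, hu n, rfl⟩)

theorem smul_mem_cover {A : SL(2, ℝ)} (hA : A ∈ S.lifts) {z : ℍ} (hz : z ∈ S.cover) :
    A • z ∈ S.cover := by
  have := S.invariant _ hA z hz
  rwa [toPGL_smul_plane] at this

theorem cover_nonempty (S : HyperbolicSurface) : S.cover.Nonempty :=
  S.interior_cover.mono interior_subset

theorem IsCusped.exists_isParabolicPoint (h : S.IsCusped) : ∃ ξ, S.IsParabolicPoint ξ := by
  obtain ⟨γ, hγ, hpar⟩ := h
  obtain ⟨A, hA, hAγ⟩ := S.exists_lift ⟨γ, hγ⟩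
  change _ = γ at hAγ
  subst hAγ
  obtain ⟨htr, -, -⟩ := trace_sq_of_isParabolicIsom hpar
  obtain ⟨v, hv, hc⟩ := exists_eigenvector (A := A) (c := A.1.trace / 2)
    (by linear_combination - htr / 4)
  obtain ⟨t, ht, ht1, htv, htA⟩ := exists_fixing_lift hA hpar hv hc
  obtain ⟨z, hz⟩ := S.cover_nonempty
  have hmem : toLine v ∈ accumulationSet S.cover :=
    mem_accumulationSet_of_tendsto (fun n => smul_mem_cover (S.lifts.pow_mem ht n) hz)
      (tendsto_planeToSphere_of_fixed ht1 hv htv z)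
  refine ⟨⟨toLine v, hmem⟩, ⟨SpecialLinearGroup.toPGL A, hA⟩, hpar, Subtype.ext ?_⟩
  change SpecialLinearGroup.toPGL A • toLine v = toLine v
  rw [← htA, toPGL_smul_toLine t hv, htv]

theorem smul_val_eq {γ : S.Γ} {A : SL(2, ℝ)} (hA : SpecialLinearGroup.toPGL A = (γ : PGL(2, ℝ)))
    {v : Fin 2 → ℝ} (hv : v ≠ 0) {ξ : S.Boundary} (hξ : toLine v = ξ.1) :
    toLine (A.1 *ᵥ v) = (γ • ξ).1 := by
  change _ = γ.1 • ξ.1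
  rw [← hA, ← hξ, toPGL_smul_toLine A hv]

theorem IsParabolicPoint.smul {ξ : S.Boundary} (h : S.IsParabolicPoint ξ) (γ : S.Γ) :
    S.IsParabolicPoint (γ • ξ) := by
  obtain ⟨δ, ⟨B, hB, hBpar⟩, hfix⟩ := h
  refine ⟨γ * δ * γ⁻¹, ?_, ?_⟩
  · obtain ⟨C, hC⟩ := ProjGenLinGroup.mk_surjective (γ : PGL(2, ℝ))
    refine ⟨C * B * C⁻¹, ?_, ?_⟩
    · simp [hB, hC]
    · exact (GeneralLinearGroup.isParabolic_conj_iff C B).2 hBpar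
  · rw [mul_smul, mul_smul, inv_smul_smul, hfix]

/-- The group of deck transformations has no elements of order two, as these would be elliptic. -/
theorem toPGL_eq_one_of_sq {A : SL(2, ℝ)} (hA : A ∈ S.lifts) (h : A ^ 2 = 1 ∨ A ^ 2 = -1) :
    SpecialLinearGroup.toPGL A = 1 := by
  have hd := det_eq_one_fin_two A
  by_contra hne
  have hsq : ∃ s : ℝ, ∀ i j, (A.1 * A.1) i j = s * (1 : Matrix (Fin 2) (Fin 2) ℝ) i j := by
    rcases h with h | h
    · refine ⟨1, fun i j => ?_⟩
      have := congrArg (fun B : SL(2, ℝ) => B.1 i j) h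
      simpa [sq] using this
    · refine ⟨-1, fun i j => ?_⟩
      have := congrArg (fun B : SL(2, ℝ) => B.1 i j) h
      simpa [sq] using this
  obtain ⟨s, hs⟩ := hsq
  have h01 := hs 0 1
  have h10 := hs 1 0
  have h00 := hs 0 0
  have h11 := hs 1 1
  simp [Matrix.mul_apply, Fin.sum_univ_two] at h01 h10 h00 h11
  -- A scalar square with nonzero trace forces the off-diagonal entries to vanish and the diagonal
  -- ones to agree, so that `A = ±1`.
  have htr : A.1 0 0 + A.1 1 1 = 0 := by
    by_contra htr
    have b0 : A.1 0 1 = 0 := (mul_eq_zero.1 (by linear_combination h01 :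
      (A.1 0 0 + A.1 1 1) * A.1 0 1 = 0)).resolve_left htr
    have c0 : A.1 1 0 = 0 := (mul_eq_zero.1 (by linear_combination h10 :
      (A.1 0 0 + A.1 1 1) * A.1 1 0 = 0)).resolve_left htr
    have ad : A.1 0 0 = A.1 1 1 := by
      have : (A.1 0 0 + A.1 1 1) * (A.1 0 0 - A.1 1 1) = 0 := by linear_combination h00 - h11
      linarith [(mul_eq_zero.1 this).resolve_left htr]
    rw [b0, ad, zero_mul, sub_zero] at hd
    have hA1 : A = 1 ∨ A = -1 := by
      rcases mul_self_eq_one_iff.1 hd with h1 | h1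
      · left
        ext i j; fin_cases i <;> fin_cases j <;> simp [b0, c0, ad, h1]
      · right
        ext i j; fin_cases i <;> fin_cases j <;> simp [b0, c0, ad, h1]
    rcases hA1 with rfl | rfl
    · exact hne (map_one _)
    · exact hne (by rw [toPGL_neg, map_one])
  have hc : A.1 1 0 ≠ 0 := by
    intro hc
    rw [hc, mul_zero, sub_zero, eq_neg_of_add_eq_zero_right htr] at hd
    nlinarith [sq_nonneg (A.1 0 0)]
  have hc' : (A.1 1 0 : ℂ) ≠ 0 := by exact_mod_cast hc
  have habs : ((|A.1 1 0| : ℝ) : ℂ) ≠ 0 := by exact_mod_cast abs_ne_zero.2 hc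
  have habs2 : ((|A.1 1 0| : ℝ) : ℂ) ^ 2 = (A.1 1 0 : ℂ) ^ 2 := by
    exact_mod_cast sq_abs (A.1 1 0)
  -- A traceless matrix of determinant 1 fixes the solutions of `(c z - a)² = -1`. This one lies in
  -- the upper half-plane, against freeness.
  let w : ℂ := (A.1 0 0 / A.1 1 0 : ℝ) + (1 / |A.1 1 0| : ℝ) * Complex.I
  let z : ℍ := ⟨w, by simp [w, hc]⟩
  refine S.free _ hA hne z ?_
  rw [toPGL_smul_plane]
  apply UpperHalfPlane.ext
  rw [UpperHalfPlane.coe_specialLinearGroup_apply]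
  have hden : (A.1 1 0 : ℂ) * z + A.1 1 1 ≠ 0 := UpperHalfPlane.denom_ne_zero (A : GL (Fin 2) ℝ) z
  change ((A.1 0 0 : ℂ) * z + A.1 0 1) / ((A.1 1 0 : ℂ) * z + A.1 1 1) = z
  rw [div_eq_iff hden]
  have hw : (A.1 1 0 : ℂ) * (z : ℂ) ^ 2 - 2 * A.1 0 0 * z - A.1 0 1 = 0 := by
    have e1 : ((A.1 1 0 : ℂ) * z - A.1 0 0) ^ 2 = -1 := by
      have : (z : ℂ) = w := rfl
      rw [this]
      simp only [w]
      push_cast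
      have e2 : (A.1 1 0 : ℂ) * (A.1 0 0 / A.1 1 0 + 1 / (|A.1 1 0| : ℝ) * Complex.I) - A.1 0 0
          = A.1 1 0 / (|A.1 1 0| : ℝ) * Complex.I := by
        field_simp; ring
      rw [e2, mul_pow, div_pow, habs2, Complex.I_sq, div_self (pow_ne_zero 2 hc'), one_mul]
    have e3 : (A.1 0 0 : ℂ) ^ 2 + A.1 0 1 * A.1 1 0 = -1 := by
      have : A.1 0 0 ^ 2 + A.1 0 1 * A.1 1 0 = -1 := by
        linear_combination -hd + A.1 0 0 * htr
      exact_mod_cast this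
    refine (mul_eq_zero.1 ?_).resolve_left hc'
    linear_combination e1 - e3
  have htr' : (A.1 0 0 : ℂ) + A.1 1 1 = 0 := by exact_mod_cast htr
  linear_combination -hw - z * htr'

/-- An eigenvalue of modulus below 1, for `A` or for its inverse, would let powers contract `v` to
the origin. -/
theorem eigenvalue_sq_eq_one {A : SL(2, ℝ)} (hA : A ∈ S.lifts) {v : Fin 2 → ℝ} (hv : v ≠ 0)
    (hε : ∃ ε > 0, ∀ B ∈ S.lifts, ε ≤ ‖B.1 *ᵥ v‖) {c : ℝ} (hc : A.1 *ᵥ v = c • v) :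
    c ^ 2 = 1 := by
  obtain ⟨ε, hε, hle⟩ := hε
  have hc0 : c ≠ 0 := by
    rintro rfl
    exact mulVec_ne_zero A hv (by rw [hc, zero_smul])
  have key : ∀ (B : SL(2, ℝ)) (d : ℝ), B ∈ S.lifts → B.1 *ᵥ v = d • v → d ≠ 0 → 1 ≤ |d| := by
    intro B d hB hd hd0
    by_contra! hlt
    have h1 : Tendsto (fun n : ℕ => |d| ^ n * ‖v‖) atTop (𝓝 (0 * ‖v‖)) :=
      (tendsto_pow_atTop_nhds_zero_of_lt_one (abs_nonneg d) hlt).mul_const _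
    rw [zero_mul] at h1
    obtain ⟨n, hn⟩ := (h1.eventually (gt_mem_nhds hε)).exists
    have h2 := hle (B ^ (n : ℤ)) (S.lifts.zpow_mem hB _)
    rw [zpow_mulVec hd0 hd, norm_smul, zpow_natCast, norm_pow, Real.norm_eq_abs] at h2
    linarith
  have h1 := key A c hA hc hc0
  have h2 := key A⁻¹ c⁻¹ (S.lifts.inv_mem hA) (by simpa using zpow_mulVec hc0 hc (-1))
    (inv_ne_zero hc0)
  rw [abs_inv] at h2
  have h3 : |c| ≤ 1 := by
    have := (one_le_inv₀ (abs_pos.2 hc0)).1 h2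
    exact this
  rw [← sq_abs, le_antisymm h3 h1, one_pow]

/-- Both eigenvalues square to 1 and their product is 1, so they coincide and `A` is scalar. -/
theorem eq_one_or_eq_neg_one {A : SL(2, ℝ)} (hA : A ∈ S.lifts) {v w : Fin 2 → ℝ} {p q : S.Boundary}
    (hv : S.IsCuspVector v p) (hw : S.IsCuspVector w q) (hne : p ≠ q)
    (h1 : toLine (A.1 *ᵥ v) = toLine v) (h2 : toLine (A.1 *ᵥ w) = toLine w) :
    A = 1 ∨ A = -1 := by
  have hcr : cross v w ≠ 0 := by
    rw [Ne, ← toLine_eq_iff hv.ne_zero hw.ne_zero, hv.toLine_eq, hw.toLine_eq]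
    exact fun h => hne (Subtype.ext h)
  rw [toLine_eq_iff (mulVec_ne_zero A hv.ne_zero) hv.ne_zero, cross_eq_zero_iff hv.ne_zero] at h1
  rw [toLine_eq_iff (mulVec_ne_zero A hw.ne_zero) hw.ne_zero, cross_eq_zero_iff hw.ne_zero] at h2
  obtain ⟨c, hc⟩ := h1
  obtain ⟨d, hd⟩ := h2
  have hc2 := eigenvalue_sq_eq_one hA hv.ne_zero hv.exists_le hc
  have hcd : c * d = 1 := by
    have := cross_mulVec A v w
    rw [hc, hd, cross_smul_left, cross_smul_right] at this
    refine mul_right_cancel₀ hcr ?_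
    linear_combination this
  have hdc : d = c := by linear_combination c * hcd - d * hc2
  subst hdc
  have hAc : A.1 = d • (1 : Matrix (Fin 2) (Fin 2) ℝ) := by
    have hcol : ∀ u, A.1 *ᵥ u = d • u := by
      intro u
      have hu : cross v w • u = cross u w • v + cross v u • w := by
        ext i
        fin_cases i <;> simp [cross] <;> ring
      have h3 : cross v w • (A.1 *ᵥ u) = cross v w • (d • u) := by
        rw [← mulVec_smul, hu, smul_comm, hu, mulVec_add, mulVec_smul, mulVec_smul, hc, hd]
        module
      exact smul_right_injective _ hcr h3
    ext i j
    have h0 := congrFun (hcol ![1, 0]) i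
    have h1 := congrFun (hcol ![0, 1]) i
    rw [mulVec_fin_two] at h0 h1
    fin_cases j
    · fin_cases i <;> simpa using h0
    · fin_cases i <;> simpa using h1
  rcases sq_eq_one_iff.1 hc2 with rfl | rfl
  · left; exact Subtype.ext (by rw [hAc, one_smul]; rfl)
  · right; exact Subtype.ext (by rw [hAc, neg_one_smul]; rfl)

/-- A deck transformation that preserves a pair of distinct parabolic fixed points is trivial. -/
theorem eq_one_of_smul_pair_eq {γ : S.Γ} {p q : S.Boundary} (hp : S.IsParabolicPoint p)
    (hq : S.IsParabolicPoint q) (hne : p ≠ q) (h : ({γ • p, γ • q} : Set S.Boundary) = {p, q}) :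
    γ = 1 := by
  obtain ⟨v, hv⟩ := hp.exists_isCuspVector
  obtain ⟨w, hw⟩ := hq.exists_isCuspVector
  obtain ⟨A, hA, hAγ⟩ := S.exists_lift γ
  have hvA := smul_val_eq hAγ hv.ne_zero hv.toLine_eq
  have hwA := smul_val_eq hAγ hw.ne_zero hw.toLine_eq
  -- The element may swap the two points, but its square fixes each of them; absence of involutions
  -- then concludes.
  have hAA : SpecialLinearGroup.toPGL (A * A) = ((γ * γ : S.Γ) : PGL(2, ℝ)) := by
    rw [map_mul, hAγ]; rfl
  have hvAA := smul_val_eq hAA hv.ne_zero hv.toLine_eq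
  have hwAA := smul_val_eq hAA hw.ne_zero hw.toLine_eq
  apply Subtype.ext
  change (γ : PGL(2, ℝ)) = 1
  rw [← hAγ]
  apply toPGL_eq_one_of_sq hA
  rw [sq]
  apply eq_one_or_eq_neg_one (S.lifts.mul_mem hA hA) hv hw hne
  · rw [hvAA, hv.toLine_eq, mul_smul]
    have := Set.pair_eq_pair_iff.1 h
    rcases this with ⟨h1, h2⟩ | ⟨h1, h2⟩
    · rw [h1, h1]
    · rw [h1, h2]
  · rw [hwAA, hw.toLine_eq, mul_smul]
    have := Set.pair_eq_pair_iff.1 h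
    rcases this with ⟨h1, h2⟩ | ⟨h1, h2⟩
    · rw [h2, h2]
    · rw [h2, h1]


/-! ### The topology of the space of geodesics -/

/-- The Vietoris conditions are to lie in `U ∪ V` and to meet both `U` and `V`. As `U` and `V` may
overlap, an assignment of the two points has to be chosen case by case. -/
theorem eventually_eq_pair {A₀ : S.GeodesicSpace} {x y : S.Boundary} (h : A₀.1 = {x, y})
    {U V : Set S.Boundary} (hU : U ∈ 𝓝 x) (hV : V ∈ 𝓝 y) :
    ∀ᶠ A : S.GeodesicSpace in 𝓝 A₀, ∃ x' ∈ U, ∃ y' ∈ V, A.1 = {x', y'} := by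
  let _ : TopologicalSpace (Set S.Boundary) := TopologicalSpace.vietoris S.Boundary
  obtain ⟨U', hUU', hU'o, hxU'⟩ := mem_nhds_iff.1 hU
  obtain ⟨V', hVV', hV'o, hyV'⟩ := mem_nhds_iff.1 hV
  have hcont : Continuous (Subtype.val : S.GeodesicSpace → Set S.Boundary) :=
    continuous_induced_dom
  have h1 := ((hU'o.union hV'o).powerset_vietoris.preimage hcont).mem_nhds
    (x := A₀) (by
      change A₀.1 ⊆ U' ∪ V'
      rw [h, Set.pair_subset_iff]
      exact ⟨Or.inl hxU', Or.inr hyV'⟩)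
  have h2 := ((TopologicalSpace.vietoris.isOpen_inter_nonempty_of_isOpen hU'o).preimage
    hcont).mem_nhds (x := A₀) ⟨x, by rw [h]; simp, hxU'⟩
  have h3 := ((TopologicalSpace.vietoris.isOpen_inter_nonempty_of_isOpen hV'o).preimage
    hcont).mem_nhds (x := A₀) ⟨y, by rw [h]; simp, hyV'⟩
  filter_upwards [h1, h2, h3] with A hA1 hA2 hA3
  obtain ⟨a, b, hab, hA⟩ := Set.ncard_eq_two.1 A.2
  change A.1 ⊆ U' ∪ V' at hA1
  obtain ⟨c, hcA, hcU⟩ := hA2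
  obtain ⟨d, hdA, hdV⟩ := hA3
  change c ∈ A.1 at hcA
  change d ∈ A.1 at hdA
  have ha : a ∈ U' ∪ V' := hA1 (by rw [hA]; simp)
  have hb : b ∈ U' ∪ V' := hA1 (by rw [hA]; simp)
  rw [hA] at hcA hdA
  have hswap : A.1 = {b, a} := by rw [hA, Set.pair_comm]
  rcases hcA with rfl | hcA <;> rcases hdA with rfl | hdA
  · rcases hb with hb | hb
    · exact ⟨b, hUU' hb, _, hVV' hdV, hswap⟩
    · exact ⟨_, hUU' hcU, b, hVV' hb, hA⟩
  · rw [Set.mem_singleton_iff] at hdA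
    subst hdA
    exact ⟨_, hUU' hcU, _, hVV' hdV, hA⟩
  · rw [Set.mem_singleton_iff] at hcA
    subst hcA
    exact ⟨_, hUU' hcU, _, hVV' hdV, hswap⟩
  · rw [Set.mem_singleton_iff] at hcA hdA
    subst hcA
    subst hdA
    rcases ha with ha | ha
    · exact ⟨a, hUU' ha, _, hVV' hdV, hA⟩
    · exact ⟨_, hUU' hcU, a, hVV' ha, hswap⟩

theorem exists_nhds_of_pair {A₀ : S.GeodesicSpace} {x y : S.Boundary} (h : A₀.1 = {x, y})
    {W : Set S.GeodesicSpace} (hW : W ∈ 𝓝 A₀) :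
    ∃ U ∈ 𝓝 x, ∃ V ∈ 𝓝 y, ∀ A : S.GeodesicSpace, ∀ x' ∈ U, ∀ y' ∈ V, A.1 = {x', y'} → A ∈ W := by
  let _ : TopologicalSpace (Set S.Boundary) := TopologicalSpace.vietoris S.Boundary
  obtain ⟨W', hW', hWW'⟩ := (mem_nhds_induced (Subtype.val : S.GeodesicSpace → _) A₀ W).1 hW
  rw [h] at hW'
  have hcont : Continuous fun p : S.Boundary × S.Boundary => ({p.1, p.2} : Set S.Boundary) := by
    have h1 := TopologicalSpace.vietoris.continuous_union.comp
      ((TopologicalSpace.vietoris.continuous_singleton.comp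
        (continuous_fst (X := S.Boundary) (Y := S.Boundary))).prodMk
      (TopologicalSpace.vietoris.continuous_singleton.comp
        (continuous_snd (X := S.Boundary) (Y := S.Boundary))))
    exact h1
  have h2 := hcont.continuousAt.preimage_mem_nhds (x := (x, y)) hW'
  rw [nhds_prod_eq, mem_prod_iff] at h2
  obtain ⟨U, hU, V, hV, hUV⟩ := h2
  refine ⟨U, hU, V, hV, fun A x' hx' y' hy' hA => hWW' ?_⟩
  change A.1 ∈ W'
  rw [hA]
  exact hUV (Set.mk_mem_prod hx' hy')

theorem continuous_smul_boundary (γ : S.Γ) : Continuous fun ξ : S.Boundary => γ • ξ := by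
  obtain ⟨A, -, hA⟩ := S.exists_lift γ
  refine continuous_induced_rng.2 ?_
  have := (continuous_toPGL_smul A).comp
    (continuous_subtype_val : Continuous fun ξ : S.Boundary => ξ.1)
  rw [hA] at this
  exact this

theorem continuous_smul_geodesicSpace (γ : S.Γ) :
    Continuous fun A : S.GeodesicSpace => γ • A := by
  let _ : TopologicalSpace (Set S.Boundary) := TopologicalSpace.vietoris S.Boundary
  refine continuous_induced_rng.2 ?_
  exact (continuous_smul_boundary γ).image_vietoris.comp continuous_induced_dom

theorem smul_val_pair (γ : S.Γ) {A : S.GeodesicSpace} {x y : S.Boundary} (h : A.1 = {x, y}) :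
    (γ • A).1 = {γ • x, γ • y} := by
  change (fun ξ => γ • ξ) '' A.1 = _
  rw [h, Set.image_pair]

theorem ne_of_val_eq_pair {A : S.GeodesicSpace} {x y : S.Boundary} (h : A.1 = {x, y}) : x ≠ y := by
  rintro rfl
  have := A.2
  simp [h] at this

/-- The distance of the endpoints of a geodesic, in the Cayley model of the boundary circle. -/
def spread (A : S.GeodesicSpace) : ℝ := Metric.diam ((fun ξ : S.Boundary => cayley ξ.1) '' A.1)

theorem spread_eq {A : S.GeodesicSpace} {x y : S.Boundary} (h : A.1 = {x, y}) :
    spread A = dist (cayley x.1) (cayley y.1) := by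
  rw [spread, h, Set.image_pair, Metric.diam_pair]

theorem spread_pos (A : S.GeodesicSpace) : 0 < spread A := by
  obtain ⟨x, y, hxy, hA⟩ := Set.ncard_eq_two.1 A.2
  rw [spread_eq hA, dist_pos]
  exact fun h => hxy (Subtype.ext (injective_cayley h))

theorem continuous_spread : Continuous (spread : S.GeodesicSpace → ℝ) := by
  rw [continuous_iff_continuousAt]
  intro A₀
  obtain ⟨x, y, -, hA₀⟩ := Set.ncard_eq_two.1 A₀.2
  have hcont : Continuous fun p : S.Boundary × S.Boundary => dist (cayley p.1.1) (cayley p.2.1) :=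
    (continuous_cayley.comp (continuous_subtype_val.comp continuous_fst)).dist
      (continuous_cayley.comp (continuous_subtype_val.comp continuous_snd))
  intro W hW
  rw [spread_eq hA₀] at hW
  have h2 := hcont.continuousAt.preimage_mem_nhds (x := (x, y)) hW
  rw [nhds_prod_eq, mem_prod_iff] at h2
  obtain ⟨U, hU, V, hV, hUV⟩ := h2
  rw [mem_map]
  filter_upwards [eventually_eq_pair hA₀ hU hV] with A ⟨x', hx', y', hy', hA⟩
  rw [Set.mem_preimage, spread_eq hA]
  exact hUV (Set.mk_mem_prod hx' hy')

theorem norm_mul_norm_mul_spread_le {A : S.GeodesicSpace} {x y : S.Boundary} (h : A.1 = {x, y})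
    {v w : Fin 2 → ℝ} (hv : v ≠ 0) (hw : w ≠ 0) (hvx : toLine v = x.1) (hwy : toLine w = y.1) :
    ‖v‖ * ‖w‖ * spread A ≤ 2 * |cross v w| := by
  rw [spread_eq h, ← dist_cayley_toLine hv hw, hvx, hwy, mul_comm]
  gcongr <;> exact norm_le_norm_toComplex _

/-- A positive continuous function has a positive minimum on a compact set. Compactness enters the
counting only through this bound. -/
theorem exists_le_spread {K : Set S.GeodesicSpace} (hK : IsCompact K) :
    ∃ ε > 0, ∀ A ∈ K, ε ≤ spread A := by
  rcases K.eq_empty_or_nonempty with rfl | hne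
  · exact ⟨1, one_pos, by simp⟩
  · obtain ⟨A, -, hA⟩ := hK.exists_isMinOn hne continuous_spread.continuousOn
    exact ⟨spread A, spread_pos A, fun B hB => hA hB⟩

/-! ### Counting measures -/

theorem out_smul_eq {H : Subgroup S.Γ} {A : S.GeodesicSpace} (hH : ∀ h ∈ H, h • A = A) (γ : S.Γ) :
    (γ : S.Γ ⧸ H).out • A = γ • A := by
  obtain ⟨h, hh⟩ := QuotientGroup.mk_out_eq_mul H γ
  rw [hh, mul_smul, hH h h.2]

/-- Left multiplication permutes the cosets, which gives invariance. A compact set lies in a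
superlevel set of `spread`, which by hypothesis meets only finitely many atoms. -/
theorem isGeodesicCurrent_cosetMeasure {H : Subgroup S.Γ} {A : S.GeodesicSpace}
    (hH : ∀ h ∈ H, h • A = A)
    (hfin : ∀ ε > 0, {c : S.Γ ⧸ H | ε ≤ spread (c.out • A)}.Finite) :
    S.IsGeodesicCurrent (S.cosetMeasure H A) where
  invariant := by
    refine ⟨fun γ s hs => ?_⟩
    have hs' : MeasurableSet ((fun B : S.GeodesicSpace => γ • B) ⁻¹' s) :=
      (continuous_smul_geodesicSpace γ).measurable hs
    rw [cosetMeasure, Measure.sum_apply _ hs', Measure.sum_apply _ hs]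
    conv_rhs => rw [← (MulAction.toPerm γ : Equiv.Perm (S.Γ ⧸ H)).tsum_eq]
    refine tsum_congr fun c => ?_
    have : (γ • c).out • A = γ • c.out • A := by
      have h1 : γ • c = ((γ * c.out : S.Γ) : S.Γ ⧸ H) := by
        conv_lhs => rw [← QuotientGroup.out_eq' c]
        rfl
      rw [h1, out_smul_eq hH, mul_smul]
    rw [Measure.dirac_apply' _ hs', Measure.dirac_apply' _ hs, MulAction.toPerm_apply, this]
    rfl
  locally_finite := by
    intro K hK
    obtain ⟨ε, hε, hKε⟩ := exists_le_spread hK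
    have hmeas : MeasurableSet {B : S.GeodesicSpace | ε ≤ spread B} :=
      (isClosed_le continuous_const continuous_spread).measurableSet
    refine (measure_mono (t := {B : S.GeodesicSpace | ε ≤ spread B}) hKε).trans_lt ?_
    rw [cosetMeasure, Measure.sum_apply _ hmeas,
      tsum_eq_sum (s := (hfin ε hε).toFinset) fun c hc => ?_]
    · exact ENNReal.sum_lt_top.2 fun c _ => measure_lt_top _ _
    · rw [Measure.dirac_apply' _ hmeas]
      have : c.out • A ∉ {B : S.GeodesicSpace | ε ≤ spread B} := by simpa using hc
      simp [this]

theorem integral_cosetMeasure {H : Subgroup S.Γ} {A : S.GeodesicSpace}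
    (hcur : S.IsGeodesicCurrent (S.cosetMeasure H A)) {f : S.GeodesicSpace → ℝ}
    (hf : Continuous f) (hfc : HasCompactSupport f) :
    ∫ B, f B ∂(S.cosetMeasure H A) = ∑' c : S.Γ ⧸ H, f (c.out • A) := by
  have : IsFiniteMeasureOnCompacts (S.cosetMeasure H A) := ⟨fun K hK => hcur.locally_finite K hK⟩
  have hint : Integrable f (S.cosetMeasure H A) := hf.integrable_of_hasCompactSupport hfc
  rw [cosetMeasure, ← (hasSum_integral_measure hint).tsum_eq]
  refine tsum_congr fun c => ?_
  exact integral_dirac' _ _ hf.measurable.stronglyMeasurable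

theorem tsum_out_smul {H : Subgroup S.Γ} (hH : H = ⊥) {A : S.GeodesicSpace}
    (f : S.GeodesicSpace → ℝ) :
    ∑' c : S.Γ ⧸ H, f (c.out • A) = ∑' γ : S.Γ, f (γ • A) := by
  subst hH
  rw [← (QuotientGroup.quotientBot (G := S.Γ)).symm.toEquiv.tsum_eq]
  refine tsum_congr fun γ => ?_
  change f ((γ : S.Γ ⧸ (⊥ : Subgroup S.Γ)).out • A) = _
  rw [out_smul_eq]
  intro h hh
  rw [Subgroup.mem_bot.1 hh, one_smul]

theorem exists_support_le_spread {f : S.GeodesicSpace → ℝ} (hfc : HasCompactSupport f) :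
    ∃ ε > 0, ∀ A, f A ≠ 0 → ε ≤ spread A := by
  obtain ⟨ε, hε, h⟩ := exists_le_spread hfc.isCompact
  exact ⟨ε, hε, fun A hA => h A (subset_tsupport f hA)⟩

/-! ### Pairs of parabolic fixed points -/

theorem cross_ne_zero_of_ne {v w : Fin 2 → ℝ} {p q : S.Boundary} (hv : S.IsCuspVector v p)
    (hw : S.IsCuspVector w q) (hne : p ≠ q) : cross v w ≠ 0 := by
  rw [Ne, ← toLine_eq_iff hv.ne_zero hw.ne_zero, hv.toLine_eq, hw.toLine_eq]
  exact fun h => hne (Subtype.ext h)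

/-- The chordal distance formula for the translated endpoints, with the determinant unchanged by
`A`. -/
theorem norm_mul_norm_le_of_le_spread {γ : S.Γ} {A : SL(2, ℝ)}
    (hA : SpecialLinearGroup.toPGL A = (γ : PGL(2, ℝ))) {B : S.GeodesicSpace} {p q : S.Boundary}
    (hB : B.1 = {p, q}) {v w : Fin 2 → ℝ} (hv : v ≠ 0) (hw : w ≠ 0) (hvp : toLine v = p.1)
    (hwq : toLine w = q.1) {ε : ℝ} (hε : 0 < ε) (h : ε ≤ spread (γ • B)) :
    ‖A.1 *ᵥ v‖ * ‖A.1 *ᵥ w‖ ≤ 2 / ε * |cross v w| := by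
  have := norm_mul_norm_mul_spread_le (smul_val_pair γ hB) (mulVec_ne_zero A hv)
    (mulVec_ne_zero A hw) (smul_val_eq hA hv hvp) (smul_val_eq hA hw hwq)
  rw [cross_mulVec] at this
  rw [div_mul_eq_mul_div, le_div_iff₀ hε]
  exact (mul_le_mul_of_nonneg_left h (by positivity)).trans this

theorem finite_le_spread {A : S.GeodesicSpace} (hA : ∀ ξ ∈ A.1, S.IsParabolicPoint ξ) {ε : ℝ}
    (hε : 0 < ε) : {γ : S.Γ | ε ≤ spread (γ • A)}.Finite := by
  obtain ⟨p, q, hpq, hApq⟩ := Set.ncard_eq_two.1 A.2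
  obtain ⟨v, hv⟩ := (hA p (by rw [hApq]; simp)).exists_isCuspVector
  obtain ⟨w, hw⟩ := (hA q (by rw [hApq]; simp)).exists_isCuspVector
  have hfin := S.hasFiniteBalls_lifts.finite_of_norm_mul_le (cross_ne_zero_of_ne hv hw hpq)
    hv.exists_le hw.exists_le (2 / ε * |cross v w|)
  refine Set.Finite.of_finite_image (f := Subtype.val)
    ((hfin.image SpecialLinearGroup.toPGL).subset ?_) Subtype.val_injective.injOn
  rintro _ ⟨γ, hγ, rfl⟩
  obtain ⟨B, hB, hBγ⟩ := S.exists_lift γ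
  exact ⟨B, ⟨hB, norm_mul_norm_le_of_le_spread hBγ hApq hv.ne_zero hw.ne_zero hv.toLine_eq
    hw.toLine_eq hε hγ⟩, hBγ⟩

theorem isGeodesicCurrent_orbitMeasure {A : S.GeodesicSpace}
    (hA : ∀ ξ ∈ A.1, S.IsParabolicPoint ξ) : S.IsGeodesicCurrent (S.orbitMeasure A) := by
  refine isGeodesicCurrent_cosetMeasure (H := MulAction.stabilizer S.Γ A)
    (fun h hh => MulAction.mem_stabilizer_iff.1 hh) fun ε hε => ?_
  have hinj : Function.Injective fun c : S.Γ ⧸ MulAction.stabilizer S.Γ A => c.out :=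
    Quotient.out_injective
  have := Set.Finite.preimage hinj.injOn (finite_le_spread hA hε)
  exact this

theorem stabilizer_eq_bot {A : S.GeodesicSpace} (hA : ∀ ξ ∈ A.1, S.IsParabolicPoint ξ) :
    MulAction.stabilizer S.Γ A = ⊥ := by
  obtain ⟨p, q, hpq, hApq⟩ := Set.ncard_eq_two.1 A.2
  rw [eq_bot_iff]
  intro γ hγ
  rw [MulAction.mem_stabilizer_iff] at hγ
  have := smul_val_pair γ hApq
  rw [hγ, hApq] at this
  exact Subgroup.mem_bot.2 (eq_one_of_smul_pair_eq (hA p (by rw [hApq]; simp))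
    (hA q (by rw [hApq]; simp)) hpq this.symm)

theorem integral_orbitMeasure {A : S.GeodesicSpace} (hA : ∀ ξ ∈ A.1, S.IsParabolicPoint ξ)
    {f : S.GeodesicSpace → ℝ} (hf : Continuous f) (hfc : HasCompactSupport f) :
    ∫ B, f B ∂(S.orbitMeasure A) = ∑' γ : S.Γ, f (γ • A) := by
  rw [← tsum_out_smul (stabilizer_eq_bot hA)]
  exact integral_cosetMeasure (isGeodesicCurrent_orbitMeasure hA) hf hfc

end HyperbolicSurface

/-- Averages over long intervals of a family of bounded functions that is close to a constant away
from the ends of the intervals. -/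
theorem tendsto_average {a : ℕ → ℤ → ℝ} {B ℓ : ℝ} (hB : ∀ n j, |a n j| ≤ B) (J : ℕ)
    (h : ∀ δ > 0, ∃ N : ℕ, ∀ (n : ℕ) (j : ℤ), |j| + N ≤ n → |a n j - ℓ| < δ) :
    Tendsto (fun n : ℕ => (1 / (2 * (n : ℝ))) *
      ∑ j ∈ Finset.Icc (-((n : ℤ) + J)) (n + J), a n j) atTop (𝓝 ℓ) := by
  rw [Metric.tendsto_atTop]
  intro δ hδ
  obtain ⟨N, hN⟩ := h (δ / 4) (by positivity)
  have hB0 : 0 ≤ B := (abs_nonneg _).trans (hB 0 0)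
  -- `C` collects the errors independent of `n`: the terms near the ends of the interval and the
  -- defect in the number of inner terms.
  set C := |ℓ| * (2 * N + 1) + 2 * B * (J + N) with hC
  have hC0 : 0 ≤ C := by positivity
  obtain ⟨N', hN'⟩ := exists_nat_gt (C / δ)
  refine ⟨N + N' + 1, fun n hn => ?_⟩
  have hn1 : (1 : ℝ) ≤ n := by exact_mod_cast (by omega : 1 ≤ n)
  have hnC : C < n * δ := by
    rw [div_lt_iff₀ hδ] at hN'
    have : (N' : ℝ) ≤ n := by exact_mod_cast (by omega : N' ≤ n)
    exact hN'.trans_le (by gcongr)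
  set big := Finset.Icc (-((n : ℤ) + J)) (n + J) with hbig
  set small := Finset.Icc (-((n : ℤ) - N)) (n - N) with hsmall
  have hsub : small ⊆ big := by
    intro j hj
    rw [hsmall, Finset.mem_Icc] at hj
    rw [hbig, Finset.mem_Icc]
    omega
  have hcs : (small.card : ℝ) = 2 * n - 2 * N + 1 := by
    rw [hsmall, Int.card_Icc]
    have : ((n : ℤ) - N + 1 - -((n : ℤ) - N)).toNat = 2 * (n - N) + 1 := by omega
    rw [this]
    push_cast [Nat.cast_sub (by omega : N ≤ n)]
    ring
  have hcb : (big.card : ℝ) = 2 * n + 2 * J + 1 := by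
    rw [hbig, Int.card_Icc]
    have : ((n : ℤ) + J + 1 - -((n : ℤ) + J)).toNat = 2 * (n + J) + 1 := by omega
    rw [this]
    push_cast
    ring
  have h1 : |∑ j ∈ big \ small, a n j| ≤ B * (2 * J + 2 * N) := by
    calc |∑ j ∈ big \ small, a n j| ≤ ∑ j ∈ big \ small, |a n j| := Finset.abs_sum_le_sum_abs _ _
      _ ≤ ∑ j ∈ big \ small, B := Finset.sum_le_sum fun j _ => hB n j
      _ = B * (big.card - small.card) := by
        rw [Finset.sum_const, nsmul_eq_mul, Finset.card_sdiff_of_subset hsub,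
          Nat.cast_sub (Finset.card_le_card hsub), mul_comm]
      _ = _ := by rw [hcb, hcs]; ring
  have h2 : |∑ j ∈ small, (a n j - ℓ)| ≤ (δ / 4) * (2 * n + 1) := by
    calc |∑ j ∈ small, (a n j - ℓ)| ≤ ∑ j ∈ small, |a n j - ℓ| := Finset.abs_sum_le_sum_abs _ _
      _ ≤ ∑ j ∈ small, δ / 4 := Finset.sum_le_sum fun j hj => (hN n j (by
          rw [hsmall, Finset.mem_Icc] at hj
          have : |j| ≤ n - N := abs_le.2 ⟨by omega, by omega⟩
          omega)).le
      _ = (δ / 4) * (2 * n - 2 * N + 1) := by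
        rw [Finset.sum_const, nsmul_eq_mul, hcs, mul_comm]
      _ ≤ _ := by
        gcongr
        have : (0 : ℝ) ≤ N := by positivity
        linarith
  have h3 : |ℓ * (1 - 2 * N)| ≤ |ℓ| * (2 * N + 1) := by
    rw [abs_mul]
    gcongr
    rw [abs_le]
    have : (0 : ℝ) ≤ N := by positivity
    constructor <;> linarith
  -- The inner interval has `2n - 2N + 1` elements instead of `2n`, hence the correction `ℓ (1 -
  -- 2N)`.
  have hsum : ∑ j ∈ big, a n j - 2 * n * ℓ
      = ∑ j ∈ big \ small, a n j + ∑ j ∈ small, (a n j - ℓ) + ℓ * (1 - 2 * N) := by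
    rw [← Finset.sum_sdiff hsub, Finset.sum_sub_distrib, Finset.sum_const, nsmul_eq_mul, hcs]
    ring
  have h4 : |∑ j ∈ big, a n j - 2 * n * ℓ| < 2 * n * δ := by
    rw [hsum]
    have := abs_add_three (∑ j ∈ big \ small, a n j) (∑ j ∈ small, (a n j - ℓ)) (ℓ * (1 - 2 * N))
    nlinarith
  rw [Real.dist_eq]
  have h5 : 1 / (2 * (n : ℝ)) * ∑ j ∈ big, a n j - ℓ
      = (∑ j ∈ big, a n j - 2 * n * ℓ) / (2 * n) := by
    field_simp
  rw [h5, abs_div, abs_of_pos (by positivity : (0 : ℝ) < 2 * n), div_lt_iff₀ (by positivity)]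
  linarith

namespace HyperbolicSurface

variable {S : HyperbolicSurface}

/-! ### The axis of a hyperbolic element -/

/-- The matrix `A` represents `g` and has a basis of eigenvectors `e` and `f`, which are coordinates
of the end points `x` and `y` of the geodesic `L`. -/
structure IsAxis (g : S.Γ) (A : SL(2, ℝ)) (l : ℝ) (e f : Fin 2 → ℝ) (x y : S.Boundary)
    (L : S.GeodesicSpace) : Prop where
  mem : A ∈ S.lifts
  toPGL_eq : SpecialLinearGroup.toPGL A = (g : PGL(2, ℝ))
  basis : IsEigenbasis A l e f
  left_eq : toLine e = x.1
  right_eq : toLine f = y.1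
  val_eq : L.1 = {x, y}

theorem exists_isAxis {g : S.Γ} (hg : IsHyperbolicIsom (g : PGL(2, ℝ))) :
    ∃ A l e f x y L, S.IsAxis g A l e f x y L := by
  obtain ⟨A, hA, hAg, l, e, f, h⟩ := S.exists_isEigenbasis_lift g hg
  obtain ⟨z, hz⟩ := S.cover_nonempty
  have he : toLine e ∈ accumulationSet S.cover :=
    mem_accumulationSet_of_tendsto (fun n => smul_mem_cover (S.lifts.zpow_mem hA _) hz)
      (h.tendsto_planeToSphere z)
  have hf : toLine f ∈ accumulationSet S.cover :=
    mem_accumulationSet_of_tendsto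
      (fun n => smul_mem_cover (S.lifts.zpow_mem (S.lifts.inv_mem hA) _) hz)
      (h.symm.tendsto_planeToSphere z)
  have hne : (⟨toLine e, he⟩ : S.Boundary) ≠ ⟨toLine f, hf⟩ := fun hef =>
    h.cross_ne ((toLine_eq_iff h.left_ne h.right_ne).1 (congrArg Subtype.val hef))
  exact ⟨A, l, e, f, ⟨toLine e, he⟩, ⟨toLine f, hf⟩, ⟨{⟨toLine e, he⟩, ⟨toLine f, hf⟩},
    Set.ncard_pair hne⟩, hA, hAg, h, rfl, rfl, rfl⟩

namespace IsAxis

variable {g : S.Γ} {A : SL(2, ℝ)} {l : ℝ} {e f : Fin 2 → ℝ} {x y : S.Boundary}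
  {L : S.GeodesicSpace}

theorem toPGL_zpow (h : S.IsAxis g A l e f x y L) (j : ℤ) :
    SpecialLinearGroup.toPGL (A ^ j) = ((g ^ j : S.Γ) : PGL(2, ℝ)) := by
  rw [map_zpow, h.toPGL_eq]
  rfl

theorem symm (h : S.IsAxis g A l e f x y L) : S.IsAxis g⁻¹ A⁻¹ l f e y x L where
  mem := S.lifts.inv_mem h.mem
  toPGL_eq := by
    rw [map_inv, h.toPGL_eq]
    rfl
  basis := h.basis.symm
  left_eq := h.right_eq
  right_eq := h.left_eq
  val_eq := by rw [h.val_eq, Set.pair_comm]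

theorem ne (h : S.IsAxis g A l e f x y L) : x ≠ y := ne_of_val_eq_pair h.val_eq

/-- The orbit of a point consists of two sequences converging to the two fixed points, and no orbit
point lies on the boundary circle. -/
theorem limitSet_eq (h : S.IsAxis g A l e f x y L) : S.limitSet (Subgroup.zpowers g) = L.1 := by
  have horb : ∀ (z : ℍ) (j : ℤ), A ^ j • z ∈ {w : ℍ | ∃ k ∈ Subgroup.zpowers g, w = k • z} := by
    intro z j
    refine ⟨g ^ j, ⟨j, rfl⟩, ?_⟩
    rw [← toPGL_smul_plane, h.toPGL_zpow]
    rfl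
  rw [h.val_eq]
  apply Set.Subset.antisymm
  · rintro ξ ⟨z, -, hξ⟩
    set u : ℕ → OnePoint ℂ := fun n => planeToSphere (A ^ (n : ℤ) • z)
    set u' : ℕ → OnePoint ℂ := fun n => planeToSphere ((A⁻¹) ^ (n : ℤ) • z)
    -- A convergent sequence together with its limit is compact, hence closed, so it contains its
    -- accumulation points.
    have hK := ((h.basis.tendsto_planeToSphere z).isCompact_insert_range.union
      (h.basis.symm.tendsto_planeToSphere z).isCompact_insert_range).isClosed
    have hsub : planeToSphere '' {w : ℍ | ∃ k ∈ Subgroup.zpowers g, w = k • z} ⊆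
        insert (circleToSphere (toLine e)) (Set.range u) ∪
          insert (circleToSphere (toLine f)) (Set.range u') := by
      rintro _ ⟨w, ⟨k, ⟨j, rfl⟩, rfl⟩, rfl⟩
      have hk : (g ^ j : S.Γ) • z = A ^ j • z := by
        rw [← toPGL_smul_plane, h.toPGL_zpow]
        rfl
      change planeToSphere ((g ^ j : S.Γ) • z) ∈ _
      rw [hk]
      obtain ⟨n, rfl | rfl⟩ := j.eq_nat_or_neg
      · exact Or.inl (Or.inr ⟨n, rfl⟩)
      · refine Or.inr (Or.inr ⟨n, ?_⟩)
        simp only [u']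
        rw [_root_.inv_zpow']
    have hmem := closure_minimal hsub hK hξ
    rcases hmem with (hm | ⟨n, hn⟩) | (hm | ⟨n, hn⟩)
    · left
      exact Subtype.ext (by rw [injective_circleToSphere hm, h.left_eq])
    · exact absurd hn (planeToSphere_ne_circleToSphere _ _)
    · right
      exact Subtype.ext (by rw [injective_circleToSphere hm, h.right_eq])
    · exact absurd hn (planeToSphere_ne_circleToSphere _ _)
  · obtain ⟨z, hz⟩ := S.cover_nonempty
    rw [Set.pair_subset_iff]
    refine ⟨⟨z, hz, ?_⟩, ⟨z, hz, ?_⟩⟩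
    · rw [← h.left_eq]
      exact mem_accumulationSet_of_tendsto (fun n => horb z n) (h.basis.tendsto_planeToSphere z)
    · rw [← h.right_eq]
      refine mem_accumulationSet_of_tendsto (fun n => ?_) (h.basis.symm.tendsto_planeToSphere z)
      rw [_root_.inv_zpow']
      exact horb z _

theorem smul_left (h : S.IsAxis g A l e f x y L) (j : ℤ) : g ^ j • x = x := by
  apply Subtype.ext
  rw [← smul_val_eq (h.toPGL_zpow j) h.basis.left_ne h.left_eq, h.basis.zpow_left,
    toLine_smul (zpow_pos h.basis.pos _).ne', h.left_eq]

theorem smul_right (h : S.IsAxis g A l e f x y L) (j : ℤ) : g ^ j • y = y := by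
  have := h.symm.smul_left (-j)
  rwa [_root_.inv_zpow', neg_neg] at this

theorem zpowers_smul (h : S.IsAxis g A l e f x y L) : ∀ k ∈ Subgroup.zpowers g, k • L = L := by
  rintro _ ⟨j, rfl⟩
  apply Subtype.ext
  change (g ^ j • L).1 = L.1
  rw [smul_val_pair _ h.val_eq, h.smul_left, h.smul_right, h.val_eq]

theorem zpow_injective (h : S.IsAxis g A l e f x y L) : Function.Injective fun j : ℤ => g ^ j := by
  intro i j hij
  have h1 : SpecialLinearGroup.toPGL (A ^ i) = SpecialLinearGroup.toPGL (A ^ j) := by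
    rw [h.toPGL_zpow, h.toPGL_zpow]
    exact congrArg Subtype.val hij
  -- The norm of the image of `e` does not see the sign ambiguity of lifts and determines the power
  -- of `l`.
  have h2 : ‖(A ^ j).1 *ᵥ e‖ = ‖(A ^ i).1 *ᵥ e‖ := by
    rcases eq_or_eq_neg_of_toPGL_eq h1 with h2 | h2
    · rw [h2]
    · rw [h2]
      change ‖(-(A ^ i).1) *ᵥ e‖ = _
      rw [neg_mulVec, norm_neg]
  have hl := h.basis.pos
  rw [h.basis.zpow_left, h.basis.zpow_left, norm_smul, norm_smul,
    Real.norm_of_nonneg (by positivity), Real.norm_of_nonneg (by positivity)] at h2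
  have h3 := mul_right_cancel₀ (norm_ne_zero_iff.2 h.basis.left_ne) h2
  exact (zpow_right_injective₀ hl h.basis.one_lt.ne' h3).symm

/-- The translates of the axis in a compact set form finitely many cosets. -/
theorem exists_finset_cosets (h : S.IsAxis g A l e f x y L) {ε : ℝ} (hε : 0 < ε) :
    ∃ F : Set (S.Γ ⧸ Subgroup.zpowers g), F.Finite ∧
      ∀ γ : S.Γ, ε ≤ spread (γ • L) → (γ : S.Γ ⧸ Subgroup.zpowers g) ∈ F := by
  obtain ⟨F, hF, hFS, hFM⟩ := h.basis.exists_finite_cosets S.hasFiniteBalls_lifts h.mem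
    (2 / ε * |cross e f|)
  refine ⟨(fun k : S.lifts => ((SpecialLinearGroup.toPGL.subgroupComap S.Γ k : S.Γ) :
    S.Γ ⧸ Subgroup.zpowers g)) '' (Subtype.val ⁻¹' F),
    (hF.preimage Subtype.val_injective.injOn).image _, fun γ hγ => ?_⟩
  obtain ⟨B, hB, hBγ⟩ := S.exists_lift γ
  obtain ⟨j, hj⟩ := hFM B hB (norm_mul_norm_le_of_le_spread hBγ h.val_eq h.basis.left_ne
    h.basis.right_ne h.left_eq h.right_eq hε hγ)
  refine ⟨⟨B * A ^ j, hFS hj⟩, hj, ?_⟩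
  have : SpecialLinearGroup.toPGL.subgroupComap S.Γ ⟨B * A ^ j, hFS hj⟩ = γ * g ^ j := by
    apply Subtype.ext
    change SpecialLinearGroup.toPGL (B * A ^ j) = (γ : PGL(2, ℝ)) * ((g ^ j : S.Γ) : PGL(2, ℝ))
    rw [map_mul, hBγ, h.toPGL_zpow]
  change ((SpecialLinearGroup.toPGL.subgroupComap S.Γ ⟨B * A ^ j, hFS hj⟩ : S.Γ) :
    S.Γ ⧸ Subgroup.zpowers g) = γ
  rw [this, eq_comm, QuotientGroup.eq]
  exact ⟨j, by simp⟩

theorem isGeodesicCurrent (h : S.IsAxis g A l e f x y L) :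
    S.IsGeodesicCurrent (S.cosetMeasure (Subgroup.zpowers g) L) := by
  refine isGeodesicCurrent_cosetMeasure h.zpowers_smul fun ε hε => ?_
  obtain ⟨F, hF, hFε⟩ := h.exists_finset_cosets hε
  refine hF.subset fun c hc => ?_
  rw [← QuotientGroup.out_eq' c]
  exact hFε _ hc

theorem tendsto_smul (h : S.IsAxis g A l e f x y L) {q : S.Boundary} (hq : S.IsParabolicPoint q) :
    Tendsto (fun n : ℕ => g ^ (n : ℤ) • q) atTop (𝓝 x) := by
  obtain ⟨w, hw⟩ := hq.exists_isCuspVector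
  obtain ⟨a, b, rfl⟩ := h.basis.exists_coords w
  have ha := h.basis.coord_ne_zero' h.mem hw.exists_le
  refine tendsto_subtype_rng.2 ?_
  rw [← h.left_eq]
  exact (h.basis.tendsto_toLine ha).congr fun n =>
    smul_val_eq (h.toPGL_zpow n) hw.ne_zero hw.toLine_eq

theorem tendsto_inv_smul (h : S.IsAxis g A l e f x y L) {p : S.Boundary}
    (hp : S.IsParabolicPoint p) : Tendsto (fun n : ℕ => g ^ (-(n : ℤ)) • p) atTop (𝓝 y) := by
  refine (h.symm.tendsto_smul hp).congr fun n => ?_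
  rw [_root_.inv_zpow']

theorem eventually_ne (h : S.IsAxis g A l e f x y L) {p q : S.Boundary}
    (hp : S.IsParabolicPoint p) (hq : S.IsParabolicPoint q) :
    ∀ᶠ n : ℕ in atTop, g ^ (-(n : ℤ)) • p ≠ g ^ (n : ℤ) • q := by
  have : T2Space S.Boundary := inferInstanceAs (T2Space {ξ : OnePoint ℝ // ξ ∈ _})
  exact ((h.tendsto_inv_smul hp).prodMk_nhds (h.tendsto_smul hq)).eventually
    ((isOpen_ne_fun continuous_fst continuous_snd).mem_nhds h.ne.symm)

end IsAxis

end HyperbolicSurface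

/-- In eigencoordinates the determinant is `(a d l⁻²ⁿ - b c l²ⁿ) cross e f`. This growth is the
right-hand side in the hypothesis of `exists_finite_ends`. -/
theorem IsEigenbasis.abs_cross_zpow_le {A : SL(2, ℝ)} {l : ℝ} {e f : Fin 2 → ℝ}
    (h : IsEigenbasis A l e f) (v w : Fin 2 → ℝ) :
    ∃ C : ℝ, ∀ n : ℕ, |cross ((A ^ (-(n : ℤ))).1 *ᵥ v) ((A ^ (n : ℤ)).1 *ᵥ w)| ≤ C * (l ^ n) ^ 2 := by
  obtain ⟨a, b, rfl⟩ := h.exists_coords v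
  obtain ⟨c, d, rfl⟩ := h.exists_coords w
  refine ⟨(|a * d| + |b * c|) * |cross e f|, fun n => ?_⟩
  have hl := h.pos
  have hln : 1 ≤ l ^ n := one_le_pow₀ h.one_lt.le
  rw [h.zpow_coords, h.zpow_coords, neg_neg, _root_.zpow_neg, zpow_natCast]
  have e1 : cross ((a * (l ^ n)⁻¹) • e + (b * l ^ n) • f) ((c * l ^ n) • e + (d * (l ^ n)⁻¹) • f)
      = (a * d * ((l ^ n)⁻¹) ^ 2 - b * c * (l ^ n) ^ 2) * cross e f := by
    simp [cross]; ring
  rw [e1, abs_mul, mul_right_comm (|a * d| + |b * c|)]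
  gcongr
  calc _ ≤ |a * d * ((l ^ n)⁻¹) ^ 2| + |b * c * (l ^ n) ^ 2| := abs_sub _ _
    _ = |a * d| * ((l ^ n)⁻¹) ^ 2 + |b * c| * (l ^ n) ^ 2 := by
      rw [abs_mul, abs_mul (b * c), abs_of_nonneg (by positivity : 0 ≤ ((l ^ n)⁻¹) ^ 2),
        abs_of_nonneg (by positivity : 0 ≤ (l ^ n) ^ 2)]
    _ ≤ |a * d| * (l ^ n) ^ 2 + |b * c| * (l ^ n) ^ 2 := by
      gcongr
      exact (inv_le_one_of_one_le₀ hln).trans hln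
    _ = _ := by ring

namespace HyperbolicSurface

variable {S : HyperbolicSurface}

/-! ### Weak-* convergence to the current of the axis -/

namespace IsAxis

variable {g : S.Γ} {A : SL(2, ℝ)} {l : ℝ} {e f : Fin 2 → ℝ} {x y : S.Boundary}
  {L : S.GeodesicSpace}

/-- The translates of the geodesic from `g⁻ⁿ p` to `gⁿ q` in a compact set are, up to finitely many
near each of the cusps, close to translates of the axis in finitely many cosets. -/
theorem exists_finset_translates (h : S.IsAxis g A l e f x y L) {p q : S.Boundary}
    (hp : S.IsParabolicPoint p) (hq : S.IsParabolicPoint q) {ε : ℝ} (hε : 0 < ε) :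
    ∃ (E : Set S.Γ) (F : Set (S.Γ ⧸ Subgroup.zpowers g)), E.Finite ∧ F.Finite ∧
      ∃ N J : ℕ, ∀ n ≥ N, ∀ B : S.GeodesicSpace,
        B.1 = {g ^ (-(n : ℤ)) • p, g ^ (n : ℤ) • q} → ∀ γ : S.Γ, ε ≤ spread (γ • B) →
        γ * g ^ (-(n : ℤ)) ∈ E ∨ γ * g ^ (n : ℤ) ∈ E ∨
          ∃ c ∈ F, ∃ j : ℤ, |j| ≤ n + J ∧ γ = c.out * g ^ j := by
  obtain ⟨v, hv⟩ := hp.exists_isCuspVector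
  obtain ⟨w, hw⟩ := hq.exists_isCuspVector
  obtain ⟨C, hC⟩ := h.basis.abs_cross_zpow_le v w
  obtain ⟨E, F, hE, hF, hFS, N, J, hEF⟩ := h.basis.exists_finite_ends S.hasFiniteBalls_lifts
    h.mem hv.exists_le hw.exists_le (2 / ε * C)
  let π : S.lifts →* S.Γ := SpecialLinearGroup.toPGL.subgroupComap S.Γ
  have hπ : ∀ {γ : S.Γ} {B : SL(2, ℝ)} (hB : SpecialLinearGroup.toPGL B = (γ : PGL(2, ℝ)))
      (j : ℤ) (hBA : B * A ^ j ∈ S.lifts), π ⟨B * A ^ j, hBA⟩ = γ * g ^ j := by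
    intro γ B hB j hBA
    apply Subtype.ext
    change SpecialLinearGroup.toPGL (B * A ^ j) = (γ : PGL(2, ℝ)) * ((g ^ j : S.Γ) : PGL(2, ℝ))
    rw [map_mul, hB, h.toPGL_zpow]
  -- The exponent `m` measures the shift between `γ` and the chosen representative of its coset. It
  -- is bounded on the finite image of `F`, and `J'` enlarges the range of `j` accordingly.
  have hrep : ∀ γ : S.Γ, ∃ m : ℤ, γ = (γ : S.Γ ⧸ Subgroup.zpowers g).out * g ^ m := by
    intro γ
    obtain ⟨⟨_, ⟨m, rfl⟩⟩, hm⟩ := QuotientGroup.mk_out_eq_mul (Subgroup.zpowers g) γ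
    refine ⟨-m, ?_⟩
    rw [hm]
    change γ = γ * g ^ m * g ^ (-m)
    rw [mul_assoc, ← _root_.zpow_add, add_neg_cancel, zpow_zero, mul_one]
  choose m hm using hrep
  have hF' : (π '' (Subtype.val ⁻¹' F)).Finite :=
    (hF.preimage Subtype.val_injective.injOn).image π
  have hE' : (π '' (Subtype.val ⁻¹' E)).Finite :=
    (hE.preimage Subtype.val_injective.injOn).image π
  obtain ⟨J', hJ'⟩ := (hF'.image fun γ => (m γ).natAbs).bddAbove
  refine ⟨π '' (Subtype.val ⁻¹' E), (fun γ : S.Γ => (γ : S.Γ ⧸ Subgroup.zpowers g)) ''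
    (π '' (Subtype.val ⁻¹' F)), hE', hF'.image _, N, J + J', fun n hn B hB γ hγ => ?_⟩
  obtain ⟨D, hD, hDγ⟩ := S.exists_lift γ
  have hmem : ∀ j : ℤ, D * A ^ j ∈ S.lifts := fun j =>
    S.lifts.mul_mem hD (S.lifts.zpow_mem h.mem j)
  have hle := norm_mul_norm_le_of_le_spread hDγ hB (mulVec_ne_zero _ hv.ne_zero)
    (mulVec_ne_zero _ hw.ne_zero) (smul_val_eq (h.toPGL_zpow _) hv.ne_zero hv.toLine_eq)
    (smul_val_eq (h.toPGL_zpow _) hw.ne_zero hw.toLine_eq) hε hγ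
  have hle2 : ‖(D * A ^ (-(n : ℤ))).1 *ᵥ v‖ * ‖(D * A ^ (n : ℤ)).1 *ᵥ w‖
      ≤ 2 / ε * C * (l ^ n) ^ 2 := by
    rw [mul_mulVec, mul_mulVec, mul_assoc (2 / ε)]
    exact hle.trans (mul_le_mul_of_nonneg_left (hC n) (by positivity))
  rcases hEF n hn D hD hle2 with h1 | h1 | ⟨j, hj, h1⟩
  · exact Or.inl ⟨⟨_, hmem _⟩, h1, hπ hDγ _ _⟩
  · exact Or.inr (Or.inl ⟨⟨_, hmem _⟩, h1, hπ hDγ _ _⟩)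
  · right; right
    have hk : γ * g ^ j ∈ π '' (Subtype.val ⁻¹' F) := ⟨⟨_, hmem j⟩, h1, hπ hDγ _ _⟩
    refine ⟨_, ⟨_, hk, rfl⟩, m (γ * g ^ j) - j, ?_, ?_⟩
    · have h2 : (m (γ * g ^ j)).natAbs ≤ J' := hJ' ⟨_, hk, rfl⟩
      rw [abs_le] at hj ⊢
      push_cast
      omega
    · rw [_root_.zpow_sub, ← mul_assoc, ← hm, mul_inv_cancel_right]

/-- Up to a bounded error the sum over the group is a sum over finitely many cosets and `|j| ≤ n +
J`; each coset contributes an average tending to the value at its translate of the axis. -/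
theorem weakStarTendsto (h : S.IsAxis g A l e f x y L) {p q : S.Boundary}
    (hp : S.IsParabolicPoint p) (hq : S.IsParabolicPoint q) {B : ℕ → S.GeodesicSpace}
    (hB : ∀ᶠ n : ℕ in atTop, (B n).1 = {g ^ (-(n : ℤ)) • p, g ^ (n : ℤ) • q}) :
    S.WeakStarTendsto (fun n => (1 / (2 * (n : ℝ≥0))) • S.orbitMeasure (B n))
      (S.cosetMeasure (Subgroup.zpowers g) L) := by
  classical
  intro φ hφ hφc
  obtain ⟨C, hC⟩ := hφc.exists_bound_of_continuous hφ
  simp only [Real.norm_eq_abs] at hC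
  have hC0 : 0 ≤ C := (abs_nonneg _).trans (hC L)
  obtain ⟨ε, hε, hsupp⟩ := exists_support_le_spread hφc
  obtain ⟨F₁, hF₁, hL⟩ := h.exists_finset_cosets hε
  obtain ⟨E, F₂, hE, hF₂, N, J, hEF⟩ := h.exists_finset_translates hp hq hε
  -- `F₁` carries the limit integral and `F₂` the translates of the approximating pairs; cosets may
  -- be added to either sum harmlessly.
  set F := hF₁.toFinset ∪ hF₂.toFinset with hFdef
  obtain ⟨N', hN'⟩ := eventually_atTop.1 hB
  rw [integral_cosetMeasure h.isGeodesicCurrent hφ hφc, tsum_eq_sum (s := F) fun c hc => ?_]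
  swap
  · by_contra hne
    have := hL _ (hsupp _ hne)
    rw [QuotientGroup.out_eq'] at this
    exact hc (Finset.mem_union_left _ (hF₁.mem_toFinset.2 this))
  have hmain : Tendsto (fun n : ℕ => ∑ c ∈ F, (1 / (2 * (n : ℝ))) *
      ∑ j ∈ Finset.Icc (-((n : ℤ) + J)) (n + J), φ ((c.out * g ^ j) • B n)) atTop
      (𝓝 (∑ c ∈ F, φ (c.out • L))) := by
    refine tendsto_finsetSum _ fun c _ => tendsto_average (fun n j => hC _) J fun δ hδ => ?_
    have hcont : Continuous fun D : S.GeodesicSpace => φ (c.out • D) :=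
      hφ.comp (continuous_smul_geodesicSpace c.out)
    have hW := hcont.continuousAt.preimage_mem_nhds (x := L) (Metric.ball_mem_nhds _ hδ)
    obtain ⟨U, hU, V, hV, hUV⟩ := exists_nhds_of_pair h.val_eq hW
    obtain ⟨N₁, hN₁⟩ := eventually_atTop.1 ((h.tendsto_smul hq).eventually hU)
    obtain ⟨N₂, hN₂⟩ := eventually_atTop.1 ((h.tendsto_inv_smul hp).eventually hV)
    refine ⟨N' + N₁ + N₂, fun n j hj => ?_⟩
    have hj' := abs_le.1 (le_refl |j|)
    have hn : N' ≤ n := by push_cast at hj; have := abs_nonneg j; omega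
    have hpair := smul_val_pair (g ^ j) (hN' n hn)
    -- Shifted by `gʲ`, the endpoints are `g^{-(n-j)} p` and `g^{n+j} q`. Both exponents are large
    -- in size when `n - |j|` is, so the pair is near the axis.
    have e1 : g ^ j • g ^ (-(n : ℤ)) • p = g ^ (-(((n : ℤ) - j).toNat : ℤ)) • p := by
      rw [smul_smul, ← _root_.zpow_add]
      congr 2
      push_cast at hj
      omega
    have e2 : g ^ j • g ^ (n : ℤ) • q = g ^ ((((n : ℤ) + j).toNat : ℤ)) • q := by
      rw [smul_smul, ← _root_.zpow_add]
      congr 2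
      push_cast at hj
      omega
    rw [e1, e2, Set.pair_comm] at hpair
    push_cast at hj
    have := hUV (g ^ j • B n) _ (hN₁ _ (by omega)) _ (hN₂ _ (by omega)) hpair
    rw [mul_smul]
    simpa [Real.dist_eq] using this
  have hrest : ∀ᶠ n : ℕ in atTop, |∑' γ : S.Γ, φ (γ • B n) - ∑ c ∈ F,
      ∑ j ∈ Finset.Icc (-((n : ℤ) + J)) (n + J), φ ((c.out * g ^ j) • B n)|
      ≤ 2 * hE.toFinset.card * C := by
    filter_upwards [eventually_ge_atTop N, hB] with n hn hBn
    set T := (F ×ˢ Finset.Icc (-((n : ℤ) + J)) (n + J)).image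
      fun r : (S.Γ ⧸ Subgroup.zpowers g) × ℤ => r.1.out * g ^ r.2 with hT
    -- These are the exceptional elements near the two cusps; their number is at most `2 |E|`,
    -- whatever `n` is.
    set X := hE.toFinset.image (fun γ => γ * g ^ (n : ℤ)) ∪
      hE.toFinset.image (fun γ => γ * g ^ (-(n : ℤ))) with hX
    -- Each group element is `c.out * g ^ j` for one pair `(c, j)` only, so the double sum counts no
    -- translate twice.
    have hinj : Function.Injective
        fun r : (S.Γ ⧸ Subgroup.zpowers g) × ℤ => r.1.out * g ^ r.2 := by
      rintro ⟨c, i⟩ ⟨d, j⟩ hcd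
      simp only at hcd
      have hmk : ∀ (c : S.Γ ⧸ Subgroup.zpowers g) (i : ℤ),
          ((c.out * g ^ i : S.Γ) : S.Γ ⧸ Subgroup.zpowers g) = c := by
        intro c i
        conv_rhs => rw [← QuotientGroup.out_eq' c]
        rw [QuotientGroup.mk_mul_of_mem _ (Subgroup.zpow_mem_zpowers g i)]
      have hc : c = d := by rw [← hmk c i, hcd, hmk]
      subst hc
      rw [h.zpow_injective (mul_left_cancel hcd)]
    have hsumT : ∑ c ∈ F, ∑ j ∈ Finset.Icc (-((n : ℤ) + J)) (n + J), φ ((c.out * g ^ j) • B n)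
        = ∑ γ ∈ T, φ (γ • B n) := by
      rw [hT, Finset.sum_image hinj.injOn, Finset.sum_product]
    have htsum : ∑' γ : S.Γ, φ (γ • B n) = ∑ γ ∈ T ∪ X, φ (γ • B n) := by
      refine tsum_eq_sum fun γ hγ => ?_
      by_contra hne
      apply hγ
      rcases hEF n hn _ hBn γ (hsupp _ hne) with h1 | h1 | ⟨c, hc, j, hj, rfl⟩
      · refine Finset.mem_union_right _ (Finset.mem_union_left _ (Finset.mem_image.2
          ⟨_, hE.mem_toFinset.2 h1, ?_⟩))
        rw [mul_assoc, ← _root_.zpow_add, neg_add_cancel, zpow_zero, mul_one]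
      · refine Finset.mem_union_right _ (Finset.mem_union_right _ (Finset.mem_image.2
          ⟨_, hE.mem_toFinset.2 h1, ?_⟩))
        rw [mul_assoc, ← _root_.zpow_add, add_neg_cancel, zpow_zero, mul_one]
      · refine Finset.mem_union_left _ (Finset.mem_image.2 ⟨(c, j), ?_, rfl⟩)
        rw [Finset.mem_product, Finset.mem_Icc]
        exact ⟨Finset.mem_union_right _ (hF₂.mem_toFinset.2 hc), abs_le.1 hj⟩
    have hcard : (X.card : ℝ) ≤ 2 * hE.toFinset.card := by
      have h1 : X.card ≤ hE.toFinset.card + hE.toFinset.card :=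
        (Finset.card_union_le _ _).trans (add_le_add Finset.card_image_le Finset.card_image_le)
      have h2 : (X.card : ℝ) ≤ hE.toFinset.card + hE.toFinset.card := by exact_mod_cast h1
      linarith
    rw [hsumT, htsum, ← Finset.union_sdiff_self_eq_union, Finset.sum_union Finset.disjoint_sdiff,
      add_sub_cancel_left]
    calc |∑ γ ∈ X \ T, φ (γ • B n)| ≤ ∑ γ ∈ X \ T, |φ (γ • B n)| :=
          Finset.abs_sum_le_sum_abs _ _
      _ ≤ ∑ γ ∈ X, |φ (γ • B n)| :=
          Finset.sum_le_sum_of_subset_of_nonneg Finset.sdiff_subset fun _ _ _ => abs_nonneg _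
      _ ≤ ∑ γ ∈ X, C := Finset.sum_le_sum fun _ _ => hC _
      _ = X.card * C := by rw [Finset.sum_const, nsmul_eq_mul]
      _ ≤ _ := by gcongr
  have hzero : Tendsto (fun n : ℕ => (1 / (2 * (n : ℝ))) * (∑' γ : S.Γ, φ (γ • B n) - ∑ c ∈ F,
      ∑ j ∈ Finset.Icc (-((n : ℤ) + J)) (n + J), φ ((c.out * g ^ j) • B n))) atTop (𝓝 0) := by
    have hlim : Tendsto (fun n : ℕ => (2 * hE.toFinset.card * C / 2) * (n : ℝ)⁻¹) atTop (𝓝 0) := by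
      simpa using (tendsto_inv_atTop_nhds_zero_nat (𝕜 := ℝ)).const_mul
        (2 * hE.toFinset.card * C / 2)
    refine squeeze_zero_norm' ?_ hlim
    filter_upwards [hrest] with n hn
    rw [norm_mul, Real.norm_eq_abs, Real.norm_eq_abs, abs_of_nonneg (by positivity)]
    calc _ ≤ 1 / (2 * (n : ℝ)) * (2 * hE.toFinset.card * C) := by gcongr
      _ = _ := by rw [one_div, mul_inv]; ring
  have hsum := hmain.add hzero
  rw [add_zero] at hsum
  refine hsum.congr' ?_
  filter_upwards [hB] with n hn
  have hpar : ∀ ξ ∈ (B n).1, S.IsParabolicPoint ξ := by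
    rw [hn]
    rintro ξ (rfl | rfl)
    · exact hp.smul _
    · exact hq.smul _
  rw [integral_smul_nnreal_measure, integral_orbitMeasure hpar hφ hφc, ← Finset.mul_sum, ← mul_add,
    add_sub_cancel, NNReal.smul_def]
  simp

end IsAxis

theorem exists_pair (S : HyperbolicSurface) {p q : ℕ → S.Boundary}
    (hpq : ∀ᶠ n in atTop, p n ≠ q n) (hp : ∀ n, S.IsParabolicPoint (p n))
    (hq : ∀ n, S.IsParabolicPoint (q n)) : ∃ B : ℕ → S.GeodesicSpace,
      (∀ n, ∀ ξ ∈ (B n).1, S.IsParabolicPoint ξ) ∧ ∀ᶠ n in atTop, (B n).1 = {p n, q n} := by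
  obtain ⟨N, hN⟩ := eventually_atTop.1 hpq
  -- Replacing `n` by `max n N` supplies genuine pairs for the finitely many indices at which the
  -- two points might coincide.
  refine ⟨fun n => ⟨{p (max n N), q (max n N)}, Set.ncard_pair (hN _ (le_max_right _ _))⟩,
    fun n => ?_, ?_⟩
  · rintro ξ (rfl | rfl)
    · exact hp _
    · exact hq _
  · filter_upwards [eventually_ge_atTop N] with n hn
    rw [max_eq_left hn]

end HyperbolicSurface

end CuspedSurface

end

open CuspedSurface in
theorem mainTheorem8 (S : HyperbolicSurface) (hcusp : S.IsCusped) (harea : S.HasFiniteArea)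
    (g : S.Γ) (hg : IsHyperbolicIsom (g : PGL(2, ℝ))) :
    -- the limit set of the cyclic group generated by `g` has two elements, so that the counting
    -- current of `g` is defined
    ∃ L : S.GeodesicSpace, L.1 = S.limitSet (Subgroup.zpowers g) ∧
      S.IsGeodesicCurrent (S.cosetMeasure (Subgroup.zpowers g) L) ∧
      -- the counting measures of pairs of parabolic fixed points are geodesic currents
      (∀ A : S.GeodesicSpace, (∀ ξ ∈ A.1, S.IsParabolicPoint ξ) →
        S.IsGeodesicCurrent (S.orbitMeasure A)) ∧
      -- approximation by pairs of parabolic fixed points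
      (∃ A : ℕ → S.GeodesicSpace, (∀ n, ∀ ξ ∈ (A n).1, S.IsParabolicPoint ξ) ∧
        S.WeakStarTendsto (fun n => (1 / (2 * (n : ℝ≥0))) • S.orbitMeasure (A n))
          (S.cosetMeasure (Subgroup.zpowers g) L)) ∧
      -- one may take the pairs of the points `g⁻ⁿ p` and `gⁿ q`
      (∀ p q : S.Boundary, S.IsParabolicPoint p → S.IsParabolicPoint q →
        (∀ᶠ n : ℕ in atTop, g ^ (-(n : ℤ)) • p ≠ g ^ (n : ℤ) • q) ∧
        ∀ A : ℕ → S.GeodesicSpace,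
          (∀ᶠ n : ℕ in atTop, (A n).1 = {g ^ (-(n : ℤ)) • p, g ^ (n : ℤ) • q}) →
          S.WeakStarTendsto (fun n => (1 / (2 * (n : ℝ≥0))) • S.orbitMeasure (A n))
            (S.cosetMeasure (Subgroup.zpowers g) L)) := by
  obtain ⟨A, l, e, f, x, y, L, h⟩ := HyperbolicSurface.exists_isAxis hg
  refine ⟨L, h.limitSet_eq.symm, h.isGeodesicCurrent,
    fun A hA => HyperbolicSurface.isGeodesicCurrent_orbitMeasure hA, ?_,
    fun p q hp hq => ⟨h.eventually_ne hp hq, fun B hB => h.weakStarTendsto hp hq hB⟩⟩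
  obtain ⟨p, hp⟩ := hcusp.exists_isParabolicPoint
  -- A single parabolic fixed point suffices, since `g⁻ⁿ p` and `gⁿ p` tend to different ends of the
  -- axis.
  obtain ⟨B, hB, hBev⟩ := S.exists_pair (h.eventually_ne hp hp) (fun n => hp.smul _)
    fun n => hp.smul _
  exact ⟨B, hB, h.weakStarTendsto hp hp hBev⟩
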